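/- **Setting.** Let $p,K\in\mathbb N$, let $O_1,\dots,O_K\subseteq[p]$ be observation patterns with $\bigcup_k O_k=[p]$, put $M_k=[p]\setminus O_k$, and let $n_1,\dots,n_K,N\ge 0$ be integers. Let $L_1,\dots,L_L$ (the modalities) be the partition of $[p]$ into the smallest number $L$ of non-empty blocks such that every $O_k$ is a union of blocks; for $a\in[p]$ let $\xi(a)\in[L]$ be the index of the block containing $a$. For $g,h\in[L]$ let $n_{g,h}=\sum_{k=1}^K n_k\mathbf 1\{L_g\cup L_h\subseteq O_k\}$. A data-generating mechanism $P$ consists of a random pair $(X,\epsilon)\in\mathbb R^p\times\mathbb R$, a vector $\beta^*=\beta^*(P)\in\mathbb R^p$ and $\sigma\ge 0$ with $\mathbb E\|X\|_2^2<\infty$, $\mathbb E[\epsilon\mid X]=0$ and $\mathrm{Var}[\epsilon\mid X]=\sigma^2$; set $Y=X^T\beta^*+\epsilon$ and $\Sigma=\mathbb E[XX^T]$. The data are independent: $n_k$ copies of $(X_{O_k},Y)$ for each $k\in[K]$, and $N$ copies of $X$. They take values in $\mathcal X=\prod_{k}(\mathbb R^{|O_k|+1})^{n_k}\times(\mathbb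 R^p)^N$ with its Borel $\sigma$-algebra. For $\chi\in(0,1]$, $C\ge 1$, $C_X$, $0<\lambda_-\le\lambda_+$, $R,B>0$ and $\kappa_\epsilon\ge 1$, let $\mathcal P_{OSS}$ be the class of mechanisms such that $\mathbb P(|X^T\theta|\le t(\theta^T\Sigma\theta)^{1/2})\le (Ct)^\chi$ for all $\theta\in\mathbb R^p\setminus\{0\}$ and $t>0$; $\|X\|_{\psi_2}\le C_X$, where $\|X\|_{\psi_2}=\sup_{\|u\|_2=1}\inf\{t>0:\mathbb E\exp((u^TX)^2/t^2)\le 2\}$; all eigenvalues of $\Sigma$ lie in $[\lambda_-,\lambda_+]$; $\|\beta^*\|_2\le B$; $\sigma\le R$; and $\mathbb E[\epsilon^8]^{1/4}\le\kappa_\epsilon\sigma^2$. Let $\mathcal P_{OSS}^{Gauss}$ be the subclass in which $X\sim N(0,\Sigma)$, $\epsilon\sim N(0,\sigma^2)$ and $\epsilon$ is independent of $X$. Let $\hat\Theta_{OSS}$ be the set of functions $\hat\beta:\mathcal X\to\mathbb R^p$ such that $x\mapsto\|\hat\beta(x)-\beta^*(P)\|_2$ is measurable for every $P\in\mathcal P_{OSS}$.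 For $z\in\mathbb R^p$, $j\in[K]$ and $i\in[p]$ put $D_j(z)=\dfrac{R^2}{R^2+\|z_{M_j}\|_2^2}$ and $\alpha_i(z)=\sum_{j=1}^K n_jD_j(z)\mathbf 1\{i\in O_j\}$. A positive number divided by $0$ is read as $+\infty$. **Theorem.** There is a universal constant $c>0$ such that the following holds. Suppose $C_X\ge\sqrt{8\lambda_+/3}$, $\kappa_\epsilon\ge 105^{1/4}$, $0<\lambda_-<\lambda_+$, and that for all $i\in[p]$ $$\inf_{\|z\|_2\le B}\alpha_i(z)\ \ge\ \frac12\max\Big\{\frac1{\lambda_-},\lambda_-\Big\}\max\Big\{\frac{R^2}{B^2},\frac{B^2}{R^2}\Big\}\,p$$ and $$\min\{1,\lambda_+^2\}\sum_{j\in[p]\setminus\{i\}}\min\Big\{\frac{B^2}{N+n_{\xi(j),\xi(i)}},\frac{R^2}{n_{\xi(j),\xi(i)}}\Big\}\ \le\ 2B^2(\lambda_+-\lambda_-)^2 .$$ Then, provided $|L_i|\ge 2$ for all $i\in[L]$, $$\inf_{\hat\beta\in\hat\Theta_{OSS}}\ \sup_{P\in\mathcal P_{OSS}^{Gauss}}\mathbb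 E\big[\|\hat\beta-\beta^*(P)\|_2^2\big]\ \ge\ c\left(\sup_{\|z\|_2\le B}\left\{\frac{R^2}{\max\{1,\lambda_-\}}\sum_{i=1}^p\frac1{\alpha_i(z)}\right\}+\min\{\lambda_+^{-2},1\}\max_{i\in[p]}\sum_{j\in[p]\setminus\{i\}}\min\Big\{\frac{B^2}{N+n_{\xi(j),\xi(i)}},\frac{R^2}{n_{\xi(j),\xi(i)}}\Big\}\right).$$ -/

import Mathlib

open MeasureTheory ProbabilityTheory
open scoped ENNReal

noncomputable section

namespace OSS

/-- The sub-Gaussian (Orlicz `ψ₂`) norm of a real random variable: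
`inf {t > 0 : E exp (f² / t²) ≤ 2}`, equal to `∞` when there is no such `t`. -/
def psi2Norm {Ω : Type*} [MeasurableSpace Ω] (f : Ω → ℝ) (μ : Measure Ω) : ℝ≥0∞ :=
  ⨅ (t : ℝ) (_ : 0 < t) (_ : ∫⁻ ω, ENNReal.ofReal (Real.exp (f ω ^ 2 / t ^ 2)) ∂μ ≤ 2),
    ENNReal.ofReal t

/-- The sub-Gaussian norm of a random vector: the supremum over unit vectors `u` of the
sub-Gaussian norm of the one-dimensional marginal in direction `u`. -/
def psi2NormVec {Ω : Type*} [MeasurableSpace Ω] {p : ℕ}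
    (X : Ω → EuclideanSpace ℝ (Fin p)) (μ : Measure Ω) : ℝ≥0∞ :=
  ⨆ (u : EuclideanSpace ℝ (Fin p)) (_ : ‖u‖ = 1), psi2Norm (fun ω => inner ℝ (X ω) u) μ

/-- A data-generating mechanism at the population level: the joint law of covariates and noise
`(X, ε)` on `ℝᵖ × ℝ`, with the regression vector `β*` and the noise level `σ` of the well-specified
linear model `Y = Xᵀ β* + ε`, `E[ε | X] = 0`, `Var[ε | X] = σ²`. -/
structure Mechanism (p : ℕ) where
  /-- joint law of `(X, ε)` -/
  law : Measure (EuclideanSpace ℝ (Fin p) × ℝ)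
  isProbabilityMeasure : IsProbabilityMeasure law
  /-- the regression vector `β*` -/
  beta : EuclideanSpace ℝ (Fin p)
  /-- the noise level -/
  sigma : ℝ
  sigma_nonneg : 0 ≤ sigma
  memLp_covariate : MemLp (fun ω : EuclideanSpace ℝ (Fin p) × ℝ => ω.1) 2 law
  memLp_noise : MemLp (fun ω : EuclideanSpace ℝ (Fin p) × ℝ => ω.2) 2 law
  condExp_noise :
    law[fun ω : EuclideanSpace ℝ (Fin p) × ℝ => ω.2 |
      MeasurableSpace.comap Prod.fst inferInstance] =ᵐ[law] 0
  condVar_noise :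
    condVar (MeasurableSpace.comap Prod.fst inferInstance)
      (fun ω : EuclideanSpace ℝ (Fin p) × ℝ => ω.2) law =ᵐ[law] fun _ => sigma ^ 2

namespace Mechanism

variable {p : ℕ}

/-- The second moment matrix `Σ = E[X Xᵀ]`. -/
def secondMoment (P : Mechanism p) : Matrix (Fin p) (Fin p) ℝ :=
  Matrix.of fun a b => ∫ ω, ω.1 a * ω.1 b ∂P.law

/-- The response `Y = Xᵀ β* + ε`. -/
def response (P : Mechanism p) (ω : EuclideanSpace ℝ (Fin p) × ℝ) : ℝ :=
  inner ℝ ω.1 P.beta + ω.2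

/-- The law of the covariates `X`. -/
def covariateLaw (P : Mechanism p) : Measure (EuclideanSpace ℝ (Fin p)) :=
  P.law.map Prod.fst

/-- The law of `(X_O, Y)`. -/
def observedLaw (P : Mechanism p) (O : Finset (Fin p)) : Measure ((O → ℝ) × ℝ) :=
  P.law.map fun ω => (fun a : O => ω.1 a, P.response ω)

/-- `P(|Xᵀθ| ≤ t ‖θ‖_Σ) ≤ (C t)^χ` for all `θ ≠ 0` and `t > 0`. -/
def SmallBall (P : Mechanism p) (χ C : ℝ) : Prop :=
  ∀ θ : EuclideanSpace ℝ (Fin p), θ ≠ 0 → ∀ t : ℝ, 0 < t →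
    P.law.real {ω | |(inner ℝ ω.1 θ : ℝ)| ≤
        t * Real.sqrt (dotProduct (fun a => θ a) (P.secondMoment.mulVec fun a => θ a))}
      ≤ (C * t) ^ χ

/-- `‖X‖_{ψ₂} ≤ C_X`. -/
def SubGaussian (P : Mechanism p) (CX : ℝ) : Prop :=
  psi2NormVec (fun ω : EuclideanSpace ℝ (Fin p) × ℝ => ω.1) P.law ≤ ENNReal.ofReal CX

/-- All eigenvalues of the symmetric matrix `Σ` lie in `[lm, lp]`. -/
def EigenBounds (P : Mechanism p) (lm lp : ℝ) : Prop :=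
  spectrum ℝ P.secondMoment ⊆ Set.Icc lm lp

/-- `E[ε⁸]^{1/4} ≤ κ σ²`. -/
def NoiseMoment (P : Mechanism p) (κ : ℝ) : Prop :=
  Integrable (fun ω : EuclideanSpace ℝ (Fin p) × ℝ => ω.2 ^ 8) P.law ∧
    (∫ ω, ω.2 ^ 8 ∂P.law) ^ (1 / 4 : ℝ) ≤ κ * P.sigma ^ 2

/-- `X ∼ N(0, Σ)`, `ε ∼ N(0, σ²)`, and `ε` is independent of `X`. -/
def IsGaussianModel (P : Mechanism p) : Prop :=
  P.covariateLaw = multivariateGaussian 0 P.secondMoment ∧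
    P.law.map Prod.snd = gaussianReal 0 (Real.toNNReal (P.sigma ^ 2)) ∧
    IndepFun (fun ω : EuclideanSpace ℝ (Fin p) × ℝ => ω.2) (fun ω => ω.1) P.law

end Mechanism

/-- The class `𝒫_OSS(χ, C, C_X, λ₋, λ₊, R, B, κ)`. -/
def classOSS (p : ℕ) (χ C CX lm lp R B κ : ℝ) : Set (Mechanism p) :=
  {P | P.SmallBall χ C ∧ P.SubGaussian CX ∧ P.EigenBounds lm lp ∧
    ‖P.beta‖ ≤ B ∧ P.sigma ≤ R ∧ P.NoiseMoment κ}

/-- The Gaussian subclass of `𝒫_OSS`. -/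
def classOSSGauss (p : ℕ) (χ C CX lm lp R B κ : ℝ) : Set (Mechanism p) :=
  {P | P ∈ classOSS p χ C CX lm lp R B κ ∧ P.IsGaussianModel}

/-- The sample space: `n k` labelled observations `(X_{O k}, Y)` for each missingness pattern `k`,
and `N` fully observed unlabelled covariate vectors. Its σ-algebra is the product (Borel) one. -/
abbrev Sample {p K : ℕ} (O : Fin K → Finset (Fin p)) (n : Fin K → ℕ) (N : ℕ) : Type :=
  ((k : Fin K) → Fin (n k) → (O k → ℝ) × ℝ) × (Fin N → EuclideanSpace ℝ (Fin p))

/-- The law of the data: all observations are independent, those of pattern `k` with law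
`P_{X_{O k} Y}` and the unlabelled ones with law `P_X`. -/
def dataLaw {p K : ℕ} (O : Fin K → Finset (Fin p)) (n : Fin K → ℕ) (N : ℕ) (P : Mechanism p) :
    Measure (Sample O n N) :=
  (Measure.pi fun k => Measure.pi fun _ : Fin (n k) => P.observedLaw (O k)).prod
    (Measure.pi fun _ : Fin N => P.covariateLaw)

/-- The estimators: functions `β̂` of the data such that `x ↦ ‖β̂(x) - β*(P)‖₂` is measurable for
every `P ∈ 𝒫_OSS`. -/
def estimators {p K : ℕ} (O : Fin K → Finset (Fin p)) (n : Fin K → ℕ) (N : ℕ)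
    (χ C CX lm lp R B κ : ℝ) : Set (Sample O n N → EuclideanSpace ℝ (Fin p)) :=
  {b | ∀ P ∈ classOSS p χ C CX lm lp R B κ, Measurable fun x => ‖b x - P.beta‖}

/-- The minimax risk `inf_{β̂} sup_{P ∈ 𝒫_OSS^Gauss} E ‖β̂ - β*(P)‖₂²`, with values in `[0, ∞]`. -/
def minimaxRiskGauss {p K : ℕ} (O : Fin K → Finset (Fin p)) (n : Fin K → ℕ) (N : ℕ)
    (χ C CX lm lp R B κ : ℝ) : ℝ≥0∞ :=
  ⨅ b ∈ estimators O n N χ C CX lm lp R B κ,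
    ⨆ P ∈ classOSSGauss p χ C CX lm lp R B κ,
      ∫⁻ x, ENNReal.ofReal (‖b x - P.beta‖ ^ 2) ∂(dataLaw O n N P)

/-- `ξ` describes a partition of the covariates into `L` nonempty blocks `{a | ξ a = i}` such that
each observation pattern is a union of blocks. -/
structure IsBlockPartition {p K L : ℕ} (O : Fin K → Finset (Fin p)) (ξ : Fin p → Fin L) :
    Prop where
  surjective : Function.Surjective ξ
  union : ∀ k, ∃ S : Finset (Fin L), ∀ a, a ∈ O k ↔ ξ a ∈ S

/-- `ξ` maps each covariate to its modality: the modalities form the partition with the least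
number of blocks for which each observation pattern is a union of blocks. -/
structure IsModalityMap {p K L : ℕ} (O : Fin K → Finset (Fin p)) (ξ : Fin p → Fin L) :
    Prop extends IsBlockPartition O ξ where
  minimal : ∀ (L' : ℕ) (ξ' : Fin p → Fin L'), IsBlockPartition O ξ' → L ≤ L'

/-- The modality `L_i`. -/
def modality {p L : ℕ} (ξ : Fin p → Fin L) (i : Fin L) : Finset (Fin p) :=
  Finset.univ.filter fun a => ξ a = i

/-- The cross-modality sample size `n_{g,h}`: the number of labelled observations in which both
modalities `g` and `h` are observed. Labelled observations are indexed by `Σ k, Fin (n k)`. -/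
def crossSize {p K L : ℕ} (O : Fin K → Finset (Fin p)) (n : Fin K → ℕ) (ξ : Fin p → Fin L)
    (g h : Fin L) : ℕ :=
  ∑ i : (Σ k : Fin K, Fin (n k)), if modality ξ g ∪ modality ξ h ⊆ O i.1 then 1 else 0

/-- `D_j(z) = R² / (R² + ‖z_{M_j}‖₂²)`, where `M_j` is the complement of `O_j`. -/
def weight {p K : ℕ} (O : Fin K → Finset (Fin p)) (R : ℝ) (z : EuclideanSpace ℝ (Fin p))
    (j : Fin K) : ℝ :=
  R ^ 2 / (R ^ 2 + ∑ a ∈ (O j)ᶜ, z a ^ 2)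

/-- The effective sample size `α_i(z) = ∑_j n_j D_j(z) 1{i ∈ O_j}`. -/
def effSize {p K : ℕ} (O : Fin K → Finset (Fin p)) (n : Fin K → ℕ) (R : ℝ)
    (z : EuclideanSpace ℝ (Fin p)) (i : Fin p) : ℝ :=
  ∑ j, if i ∈ O j then (n j : ℝ) * weight O R z j else 0

/-- `∑_{j ≠ i} min {B² / (N + n_{ξ(j),ξ(i)}), R² / n_{ξ(j),ξ(i)}}` with values in `[0, ∞]`, where a
positive number divided by `0` is `∞`. -/
def crossSum {p K L : ℕ} (O : Fin K → Finset (Fin p)) (n : Fin K → ℕ) (N : ℕ)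
    (ξ : Fin p → Fin L) (R B : ℝ) (i : Fin p) : ℝ≥0∞ :=
  ∑ j ∈ Finset.univ.erase i,
    min (ENNReal.ofReal (B ^ 2) / ((N + crossSize O n ξ (ξ j) (ξ i) : ℕ) : ℝ≥0∞))
      (ENNReal.ofReal (R ^ 2) / (crossSize O n ξ (ξ j) (ξ i) : ℝ≥0∞))

end OSS

end

/-!
The minimax risk is bounded below by Assouad's lemma, applied to two hypercubes of Gaussian
mechanisms.

*Testing.* The distance between two laws is measured by their Hellinger affinity, in the dual form
`inf_f (∫ f dP + ∫ f⁻¹ dQ) / 2`. In this form the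
defect `1 - affinity` visibly decreases under push-forwards, it is subadditive over independent
observations (`AffinityDefectLE.prod`), and hypotheses with a small defect cannot be told apart
(`AffinityDefectLE.one_div_sixteen_le`). All mechanisms are realised on the same space, as images of
independent Gaussian variables `g` and a Gaussian noise. A change of a sign `τ j` amounts either to
a reflection of `g j`, which costs nothing, or to a shift of the other variables by a multiple of
`g j` (`affinityDefectLE_gaussianBase_shear`). The cost of the shift is explicit; that it may be
distributed freely over the variables takes the place of any computation with conditional
covariance matrices.

*First term* (`effSize_bound`). The covariance matrix is `λ₋ I`. In each modality one coefficient is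
large, with the effect that the unobserved covariates inflate the noise as the given `z` would; the
others are `± δ a`, with `δ a ^ 2` of the order `R ^ 2 / α a`. A sign is only visible in the
patterns in which its covariate is observed, because the remaining ones depend on the coefficients of the
unobserved covariates through their squares. A modality has at least two elements, so that at least
half of the sum is retained.

*Second term* (`cross_bound`). For fixed `i` the coefficient of `X i` is `B / 2`, the covariances of
`X i` with the other covariates have random signs, and the other coefficients are such that all
`X j` with `j ≠ i` are uncorrelated with the response. A sign is then only visible in
observations which contain both `X i` and `X j`; the cost is of order
`(N + n_{ξ(j),ξ(i)}) / λ₊ ^ 2 + n_{ξ(j),ξ(i)} B ^ 2 / (λ₊ R ^ 2)` times the squared covariance.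
-/

namespace OSS

open scoped NNReal

/-! ### Hellinger affinity in variational form -/

section Affinity

variable {𝒳 𝒴 : Type*} [MeasurableSpace 𝒳] [MeasurableSpace 𝒴]

/-- The Hellinger affinity of `P` and `Q` is at least `1 - e`. For probability measures the affinity
`∫ √(dP dQ)` equals `inf_f (∫ f dP + ∫ f⁻¹ dQ) / 2` over measurable `f : 𝒳 → [0, ∞]`, and this
dual form is taken as the definition: it needs no densities, and it behaves well under
push-forwards, mixtures and products. -/
def AffinityDefectLE (P Q : Measure 𝒳) (e : ℝ) : Prop :=
  ∀ f : 𝒳 → ℝ≥0∞, Measurable f →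
    ENNReal.ofReal (2 * (1 - e)) ≤ ∫⁻ x, f x ∂P + ∫⁻ x, (f x)⁻¹ ∂Q

lemma AffinityDefectLE.mono {P Q : Measure 𝒳} {e e' : ℝ} (h : AffinityDefectLE P Q e)
    (hee : e ≤ e') : AffinityDefectLE P Q e' := fun f hf =>
  (ENNReal.ofReal_le_ofReal (by linarith)).trans (h f hf)

/-- The inequality of arithmetic and geometric means in `[0, ∞]`. The infinite cases are listed
separately because of the convention `0 * ∞ = 0`. -/
lemma two_mul_le_add_of_sq_le_mul {a : ℝ≥0∞} (ha : a ≠ ∞) {F G : ℝ≥0∞}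
    (h : a ^ 2 ≤ F * G ∨ F = ∞ ∨ G = ∞) :
    2 * a ≤ F + G := by
  rcases h with h | h | h
  · by_cases hF : F = ∞
    · simp [hF]
    by_cases hG : G = ∞
    · simp [hG]
    lift F to NNReal using hF
    lift G to NNReal using hG
    lift a to NNReal using ha
    norm_cast at h ⊢
    rw [← NNReal.coe_le_coe] at h ⊢
    push_cast at h ⊢
    have h1 := F.2
    have h2 := G.2
    refine abs_le_of_sq_le_sq' ?_ (by positivity) |>.2
    nlinarith [sq_nonneg ((F : ℝ) - G)]
  · simp [h]
  · simp [h]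

lemma AffinityDefectLE.refl (P : Measure 𝒳) [IsProbabilityMeasure P] : AffinityDefectLE P P 0 := by
  intro f hf
  rw [← lintegral_add_left hf]
  calc ENNReal.ofReal (2 * (1 - 0)) = ∫⁻ _, 2 ∂P := by simp
    _ ≤ _ := by
      refine lintegral_mono fun x => ?_
      have := two_mul_le_add_of_sq_le_mul (a := 1) (by simp) (F := f x) (G := (f x)⁻¹) ?_
      · simpa using this
      by_cases h0 : f x = 0
      · simp [h0]
      by_cases h1 : f x = ∞
      · simp [h1]
      left; rw [ENNReal.mul_inv_cancel h0 h1]; simp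

lemma AffinityDefectLE.map {P Q : Measure 𝒳} {e : ℝ} (h : AffinityDefectLE P Q e)
    {F : 𝒳 → 𝒴} (hF : Measurable F) : AffinityDefectLE (P.map F) (Q.map F) e := by
  intro f hf
  have hfi : Measurable fun x => (f x)⁻¹ := hf.inv
  rw [lintegral_map hf hF, lintegral_map hfi hF]
  exact h _ (hf.comp hF)

/-- The defect of the affinity is subadditive under products. -/
lemma AffinityDefectLE.prod {P₁ Q₁ : Measure 𝒳} {P₂ Q₂ : Measure 𝒴} [SFinite P₁] [SFinite Q₁]
    [SFinite P₂] [SFinite Q₂] {e₁ e₂ : ℝ} (h₁ : AffinityDefectLE P₁ Q₁ e₁)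
    (h₂ : AffinityDefectLE P₂ Q₂ e₂) (he₁ : 0 ≤ e₁) (he₂ : 0 ≤ e₂) :
    AffinityDefectLE (P₁.prod P₂) (Q₁.prod Q₂) (e₁ + e₂) := by
  intro f hf
  by_cases hlt : e₁ + e₂ < 1
  swap
  · rw [ENNReal.ofReal_of_nonpos (by linarith)]; exact zero_le
  set a : ℝ≥0∞ := ENNReal.ofReal (1 - e₂) with ha
  have ha0 : a ≠ 0 := by simp [ha]; linarith
  have hat : a ≠ ∞ := ENNReal.ofReal_ne_top
  have hfi : Measurable fun q => (f q)⁻¹ := hf.inv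
  rw [lintegral_prod _ hf.aemeasurable, lintegral_prod _ hfi.aemeasurable]
  set F : 𝒳 → ℝ≥0∞ := fun x => ∫⁻ y, f (x, y) ∂P₂ with hFdef
  have hFm : Measurable F := hf.lintegral_prod_right'
  -- Rescaling `f (x, ·)` by constants turns the additive bound into a multiplicative one.
  have key : ∀ x, a * (F x / a)⁻¹ ≤ ∫⁻ y, (f (x, y))⁻¹ ∂Q₂ := by
    intro x
    have hfx : Measurable fun y => f (x, y) := hf.comp measurable_prodMk_left
    have scale : ∀ t : ℝ≥0∞, t ≠ 0 → t ≠ ∞ →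
        2 * a ≤ t * F x + t⁻¹ * ∫⁻ y, (f (x, y))⁻¹ ∂Q₂ := by
      intro t ht0 ht
      have := h₂ (fun y => t * f (x, y)) (hfx.const_mul t)
      rw [lintegral_const_mul _ hfx] at this
      simp_rw [ENNReal.mul_inv (Or.inl ht0) (Or.inl ht)] at this
      have hfxi : Measurable fun y => (f (x, y))⁻¹ := hfx.inv
      rw [lintegral_const_mul _ hfxi, ENNReal.ofReal_mul (by norm_num)] at this
      simpa [ha] using this
    by_cases hFt : F x = ∞
    · simp [hFt, ENNReal.top_div_of_ne_top hat]
    by_cases hF0 : F x = 0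
    · have : ∫⁻ y, (f (x, y))⁻¹ ∂Q₂ = ∞ := by
        by_contra hG
        obtain ⟨t, ht1, ht2⟩ : ∃ t : ℝ≥0∞, t ≠ 0 ∧ t * ∫⁻ y, (f (x, y))⁻¹ ∂Q₂ < 2 * a ∧ t ≠ ∞ := by
          obtain ⟨n, hn⟩ := ENNReal.exists_nat_mul_gt (a := 2 * a)
            (b := ∫⁻ y, (f (x, y))⁻¹ ∂Q₂) (by simp [ha0]) hG
          refine ⟨(n : ℝ≥0∞)⁻¹, by simp, ?_⟩
          have hn0 : (n : ℝ≥0∞) ≠ 0 := by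
            rintro h0
            simp [h0] at hn
          refine ⟨?_, by simpa using hn0⟩
          rw [mul_comm, ← div_eq_mul_inv]
          exact (ENNReal.div_lt_iff (Or.inl hn0) (Or.inl (by simp))).2 (by rwa [mul_comm])
        have := scale t⁻¹ (by simpa using ht2.2) (by simpa using ht1)
        rw [hF0, mul_zero, zero_add, inv_inv] at this
        exact absurd this (not_le.2 ht2.1)
      rw [this]; exact le_top
    · have h := scale (a / F x) (ENNReal.div_ne_zero.2 ⟨ha0, hFt⟩)
        (ENNReal.div_ne_top hat hF0)
      rw [ENNReal.div_mul_cancel hF0 hFt, two_mul] at h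
      have h' := (ENNReal.add_le_add_iff_left hat).1 h
      have hinv : (a / F x)⁻¹ = F x / a := ENNReal.inv_div (Or.inl hFt) (Or.inl hF0)
      rw [hinv] at h'
      have hd0 : F x / a ≠ 0 := ENNReal.div_ne_zero.2 ⟨hF0, hat⟩
      have hdt : F x / a ≠ ∞ := ENNReal.div_ne_top hFt ha0
      rw [mul_comm, ← ENNReal.div_eq_inv_mul]
      exact ENNReal.div_le_of_le_mul' h'
  calc ENNReal.ofReal (2 * (1 - (e₁ + e₂)))
      ≤ ENNReal.ofReal ((1 - e₂) * (2 * (1 - e₁))) :=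
        ENNReal.ofReal_le_ofReal (by nlinarith)
    _ = a * ENNReal.ofReal (2 * (1 - e₁)) := ENNReal.ofReal_mul (by linarith)
    _ ≤ a * (∫⁻ x, F x / a ∂P₁ + ∫⁻ x, (F x / a)⁻¹ ∂Q₁) := by
        gcongr; exact h₁ _ (hFm.div_const a)
    _ = ∫⁻ x, F x ∂P₁ + ∫⁻ x, a * (F x / a)⁻¹ ∂Q₁ := by
        have hFi : Measurable fun x => (F x / a)⁻¹ := (hFm.div_const a).inv
        rw [mul_add, ← lintegral_const_mul _ (hFm.div_const a), ← lintegral_const_mul _ hFi]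
        congr 1
        refine lintegral_congr fun x => ?_
        exact ENNReal.mul_div_cancel ha0 hat
    _ ≤ _ := by gcongr with x; exact key x

lemma AffinityDefectLE.pi_fin {n : ℕ} {α : Fin n → Type*} [∀ i, MeasurableSpace (α i)]
    {P Q : ∀ i, Measure (α i)} [∀ i, SigmaFinite (P i)] [∀ i, SigmaFinite (Q i)]
    {e : Fin n → ℝ} (h : ∀ i, AffinityDefectLE (P i) (Q i) (e i)) (he : ∀ i, 0 ≤ e i) :
    AffinityDefectLE (Measure.pi P) (Measure.pi Q) (∑ i, e i) := by
  induction n with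
  | zero =>
    have : Measure.pi P = Measure.pi Q := by
      rw [Measure.pi_of_empty P, Measure.pi_of_empty Q]
    rw [this, Measure.pi_of_empty Q]
    simpa using AffinityDefectLE.refl _
  | succ n ih =>
    have hP := (measurePreserving_piFinSuccAbove P 0).symm.map_eq
    have hQ := (measurePreserving_piFinSuccAbove Q 0).symm.map_eq
    rw [← hP, ← hQ, Fin.sum_univ_succ]
    refine AffinityDefectLE.map ?_ (MeasurableEquiv.measurable _)
    refine (h 0).prod ?_ (he 0) (Finset.sum_nonneg fun i _ => he _)
    exact ih (fun i => h i.succ) (fun i => he i.succ)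

lemma ofReal_integral_le_lintegral_ofReal {μ : Measure 𝒳} {g : 𝒳 → ℝ} (hg : Integrable g μ) :
    ENNReal.ofReal (∫ x, g x ∂μ) ≤ ∫⁻ x, ENNReal.ofReal (g x) ∂μ := by
  rw [integral_eq_lintegral_pos_part_sub_lintegral_neg_part hg]
  refine (ENNReal.ofReal_le_ofReal (sub_le_self _ ENNReal.toReal_nonneg)).trans ?_
  exact ENNReal.ofReal_toReal_le

/-- A random transformation `s x` of the second component, indexed by the first one, has an affinity
defect which is at most the average of the individual defects. -/
lemma AffinityDefectLE.mixture {𝒵 : Type*} [MeasurableSpace 𝒵] {μ : Measure 𝒳} {ν : Measure 𝒴}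
    [IsProbabilityMeasure μ] [SFinite ν]
    {s : 𝒳 → 𝒴 → 𝒴} (hs : Measurable (Function.uncurry s)) {e : 𝒳 → ℝ} (he : Integrable e μ)
    (h : ∀ x, AffinityDefectLE ν (ν.map (s x)) (e x)) {F : 𝒳 × 𝒴 → 𝒵} (hF : Measurable F) :
    AffinityDefectLE ((μ.prod ν).map F) ((μ.prod ν).map fun q => F (q.1, s q.1 q.2))
      (∫ x, e x ∂μ) := by
  intro f hf
  have hS : Measurable fun q : 𝒳 × 𝒴 => F (q.1, s q.1 q.2) :=
    hF.comp (measurable_fst.prodMk hs)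
  have hfi : Measurable fun x => (f x)⁻¹ := hf.inv
  have hfF : Measurable fun q => f (F q) := hf.comp hF
  have hfS : Measurable fun q : 𝒳 × 𝒴 => (f (F (q.1, s q.1 q.2)))⁻¹ := hfi.comp hS
  rw [lintegral_map hf hF, lintegral_map hfi hS,
    lintegral_prod _ hfF.aemeasurable, lintegral_prod _ hfS.aemeasurable,
    ← lintegral_add_left (Measurable.lintegral_prod_right' (f := fun q => f (F q)) (hf.comp hF))]
  calc ENNReal.ofReal (2 * (1 - ∫ x, e x ∂μ)) = ENNReal.ofReal (∫ x, 2 * (1 - e x) ∂μ) := by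
        rw [integral_const_mul, integral_sub (integrable_const _) he]; simp
    _ ≤ ∫⁻ x, ENNReal.ofReal (2 * (1 - e x)) ∂μ :=
        ofReal_integral_le_lintegral_ofReal (((integrable_const _).sub he).const_mul _)
    _ ≤ _ := by
        refine lintegral_mono fun x => ?_
        have hFx : Measurable fun y => F (x, y) := hF.comp measurable_prodMk_left
        have hsx : Measurable (s x) := hs.comp measurable_prodMk_left
        have := h x (fun y => f (F (x, y))) (hf.comp hFx)
        have hfFi : Measurable fun y => (f (F (x, y)))⁻¹ := hfi.comp hFx
        rwa [lintegral_map hfFi hsx] at this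

/-- Two hypotheses with large affinity cannot both be decided well: if two losses `f` and `g` add up
to at least `1` everywhere, then their total expectation is bounded below. -/
lemma AffinityDefectLE.one_div_sixteen_le {P Q : Measure 𝒳} [IsProbabilityMeasure P]
    [IsProbabilityMeasure Q] (h : AffinityDefectLE P Q (1 / 2)) {f g : 𝒳 → ℝ≥0∞}
    (hf : Measurable f) (hg : Measurable g) (hfg : ∀ x, 1 ≤ f x + g x) :
    1 / 16 ≤ ∫⁻ x, f x ∂P + ∫⁻ x, g x ∂Q := by
  classical
  -- On `{1/2 ≤ f}` the test function is `4`, elsewhere `1/4`.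
  have hA : MeasurableSet {x | 1 / 2 ≤ f x} := measurableSet_le measurable_const hf
  have h4 := h (fun x => if 1 / 2 ≤ f x then 4 else 4⁻¹)
    (Measurable.ite hA measurable_const measurable_const)
  have e1 : ∫⁻ x, (if 1 / 2 ≤ f x then 4 else 4⁻¹ : ℝ≥0∞) ∂P ≤ 8 * ∫⁻ x, f x ∂P + 4⁻¹ := by
    calc _ ≤ ∫⁻ x, (8 * f x + 4⁻¹) ∂P := by
          refine lintegral_mono fun x => ?_
          dsimp only
          split_ifs with hx
          · refine le_trans ?_ le_self_add
            calc (4 : ℝ≥0∞) = 8 * (1 / 2) := by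
                  rw [show (8 : ℝ≥0∞) = 4 * 2 by norm_num, one_div, mul_assoc,
                    ENNReal.mul_inv_cancel (by simp) (by simp), mul_one]
              _ ≤ _ := by gcongr
          · exact le_add_self
      _ = _ := by rw [lintegral_add_right _ measurable_const, lintegral_const_mul _ hf]; simp
  have e2 : ∫⁻ x, (if 1 / 2 ≤ f x then 4 else 4⁻¹ : ℝ≥0∞)⁻¹ ∂Q ≤ 8 * ∫⁻ x, g x ∂Q + 4⁻¹ := by
    calc _ ≤ ∫⁻ x, (8 * g x + 4⁻¹) ∂Q := by
          refine lintegral_mono fun x => ?_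
          dsimp only
          split_ifs with hx
          · exact le_add_self
          · refine le_trans ?_ le_self_add
            have : 1 / 2 ≤ g x := by
              by_contra hlt
              refine absurd (hfg x) (not_le.2 ?_)
              calc f x + g x < 1 / 2 + 1 / 2 := ENNReal.add_lt_add (not_le.1 hx) (not_le.1 hlt)
                _ = 1 := ENNReal.add_halves 1
            calc (4⁻¹⁻¹ : ℝ≥0∞) = 8 * (1 / 2) := by
                  rw [inv_inv, show (8 : ℝ≥0∞) = 4 * 2 by norm_num, one_div, mul_assoc,
                    ENNReal.mul_inv_cancel (by simp) (by simp), mul_one]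
              _ ≤ _ := by gcongr
      _ = _ := by rw [lintegral_add_right _ measurable_const, lintegral_const_mul _ hg]; simp
  have h5 : (1 : ℝ≥0∞) ≤ 8 * (∫⁻ x, f x ∂P + ∫⁻ x, g x ∂Q) + 1 / 2 := by
    calc (1 : ℝ≥0∞) = ENNReal.ofReal (2 * (1 - 1 / 2)) := by norm_num
      _ ≤ _ := h4
      _ ≤ (8 * ∫⁻ x, f x ∂P + 4⁻¹) + (8 * ∫⁻ x, g x ∂Q + 4⁻¹) := add_le_add e1 e2
      _ = 8 * (∫⁻ x, f x ∂P + ∫⁻ x, g x ∂Q) + 2 * 4⁻¹ := by ring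
      _ = _ := by
        congr 1
        rw [show (4 : ℝ≥0∞) = 2 * 2 by norm_num, ENNReal.mul_inv (by simp) (by simp), ← mul_assoc,
          ENNReal.mul_inv_cancel (by simp) (by simp), one_div, one_mul]
  by_cases ht : ∫⁻ x, f x ∂P + ∫⁻ x, g x ∂Q = ∞
  · rw [ht]; exact le_top
  generalize ∫⁻ x, f x ∂P + ∫⁻ x, g x ∂Q = S at h5 ht
  have h6 := ENNReal.toReal_mono (by finiteness) h5
  rw [ENNReal.toReal_add (by finiteness) (by finiteness)] at h6
  simp at h6
  rw [← ENNReal.ofReal_toReal ht, ENNReal.le_ofReal_iff_toReal_le (by finiteness) (by positivity)]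
  simp
  linarith

end Affinity

/-! ### Gaussian shifts -/

lemma affinityDefectLE_gaussianReal_shift {v : ℝ≥0} (hv : v ≠ 0) (u : ℝ) :
    AffinityDefectLE (gaussianReal 0 v) ((gaussianReal 0 v).map (· + u)) (u ^ 2 / (8 * v)) := by
  intro f hf
  have hv' : (0 : ℝ) < v := by positivity
  have hfi : Measurable fun x => (f x)⁻¹ := hf.inv
  rw [gaussianReal_map_add_const, zero_add, gaussianReal_of_var_ne_zero _ hv,
    gaussianReal_of_var_ne_zero _ hv,
    lintegral_withDensity_eq_lintegral_mul _ (measurable_gaussianPDF _ _) hf,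
    lintegral_withDensity_eq_lintegral_mul _ (measurable_gaussianPDF _ _) hfi,
    ← lintegral_add_left ((measurable_gaussianPDF _ _).mul hf)]
  -- The geometric mean of the two densities is `c` times the density centred at the midpoint.
  set c : ℝ := Real.exp (-(u ^ 2 / (8 * v))) with hc
  have hprod : ∀ x, (ENNReal.ofReal c * gaussianPDF (u / 2) v x) ^ 2
      = gaussianPDF 0 v x * gaussianPDF u v x := by
    intro x
    simp only [gaussianPDF]
    rw [← ENNReal.ofReal_mul (by positivity), ← ENNReal.ofReal_mul (gaussianPDFReal_nonneg _ _ _),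
      ← ENNReal.ofReal_pow (mul_nonneg (by positivity) (gaussianPDFReal_nonneg _ _ _))]
    congr 1
    simp only [gaussianPDFReal, hc]
    have : Real.exp (-(u ^ 2 / (8 * v))) ^ 2 * Real.exp (-(x - u / 2) ^ 2 / (2 * v)) ^ 2
        = Real.exp (-(x - 0) ^ 2 / (2 * v)) * Real.exp (-(x - u) ^ 2 / (2 * v)) := by
      rw [← Real.exp_nat_mul, ← Real.exp_nat_mul, ← Real.exp_add, ← Real.exp_add]
      congr 1
      field_simp
      ring
    linear_combination (Real.sqrt (2 * Real.pi * v))⁻¹ ^ 2 * this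
  calc ENNReal.ofReal (2 * (1 - u ^ 2 / (8 * v))) ≤ ENNReal.ofReal (2 * c) := by
        refine ENNReal.ofReal_le_ofReal ?_
        have := Real.add_one_le_exp (-(u ^ 2 / (8 * v)))
        linarith
    _ = ∫⁻ x, 2 * (ENNReal.ofReal c * gaussianPDF (u / 2) v x) := by
        rw [lintegral_const_mul _ ((measurable_gaussianPDF _ _).const_mul _),
          lintegral_const_mul _ (measurable_gaussianPDF _ _),
          lintegral_gaussianPDF_eq_one _ hv, ENNReal.ofReal_mul (by norm_num)]
        simp
    _ ≤ _ := by
        refine lintegral_mono fun x => ?_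
        refine two_mul_le_add_of_sq_le_mul
          (ENNReal.mul_ne_top ENNReal.ofReal_ne_top gaussianPDF_ne_top) ?_
        have p0 := (gaussianPDF_pos 0 hv x).ne'
        have p1 := (gaussianPDF_pos u hv x).ne'
        simp only [Pi.mul_apply]
        by_cases h0 : f x = 0
        · right; right
          simp [h0, p1]
        by_cases h1 : f x = ∞
        · right; left
          simp [h1, p0]
        left
        rw [hprod, mul_mul_mul_comm, ENNReal.mul_inv_cancel h0 h1, mul_one]

/-- The law of independent centred Gaussian variables with variances `v a`, together with an
independent centred Gaussian variable of variance `w`. -/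
noncomputable def gaussianBase {p : ℕ} (v : Fin p → ℝ≥0) (w : ℝ≥0) : Measure ((Fin p → ℝ) × ℝ) :=
  (Measure.pi fun a => gaussianReal 0 (v a)).prod (gaussianReal 0 w)

instance {p : ℕ} (v : Fin p → ℝ≥0) (w : ℝ≥0) : IsProbabilityMeasure (gaussianBase v w) := by
  unfold gaussianBase; infer_instance

section Base

variable {p : ℕ} {v : Fin p → ℝ≥0} {w : ℝ≥0}

lemma affinityDefectLE_gaussianBase_shift (hv : ∀ a, v a ≠ 0) (hw : w ≠ 0)
    (d : Fin p → ℝ) (d₀ : ℝ) :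
    AffinityDefectLE (gaussianBase v w) ((gaussianBase v w).map fun q => (q.1 + d, q.2 + d₀))
      (∑ a, d a ^ 2 / (8 * v a) + d₀ ^ 2 / (8 * w)) := by
  have e1 : (gaussianBase v w).map (fun q => (q.1 + d, q.2 + d₀))
      = (Measure.pi fun a => (gaussianReal 0 (v a)).map (· + d a)).prod
        ((gaussianReal 0 w).map (· + d₀)) := by
    have : ∀ a, IsProbabilityMeasure ((gaussianReal 0 (v a)).map (· + d a)) := fun a =>
      Measure.isProbabilityMeasure_map (by fun_prop)
    have h1 := Measure.pi_map_pi (μ := fun a => gaussianReal 0 (v a))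
      (f := fun a x => x + d a) (fun a => by fun_prop)
    rw [← h1, Measure.map_prod_map _ _ (by fun_prop) (by fun_prop)]
    rfl
  rw [e1, gaussianBase]
  have : ∀ a, IsProbabilityMeasure ((gaussianReal 0 (v a)).map (· + d a)) := fun a =>
      Measure.isProbabilityMeasure_map (by fun_prop)
  exact (AffinityDefectLE.pi_fin (fun a => affinityDefectLE_gaussianReal_shift (hv a) (d a))
    (fun a => by positivity)).prod (affinityDefectLE_gaussianReal_shift hw d₀)
      (Finset.sum_nonneg fun a _ => by positivity) (by positivity)

/-- Resampling one coordinate does not change the law. -/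
lemma gaussianBase_eq_map_update (j : Fin p) :
    ((gaussianReal 0 (v j)).prod (gaussianBase v w)).map
      (fun r => (Function.update r.2.1 j r.1, r.2.2)) = gaussianBase v w := by
  set G := Measure.pi fun a => gaussianReal 0 (v a) with hG
  have hm : Measurable fun r : ℝ × (Fin p → ℝ) => Function.update r.2 j r.1 :=
    measurable_update'.comp measurable_swap
  have h1 : ((gaussianReal 0 (v j)).prod G).map (fun r => Function.update r.2 j r.1) = G := by
    rw [hG]
    refine (Measure.pi_eq fun s hs => ?_).symm
    rw [Measure.map_apply hm (MeasurableSet.univ_pi hs)]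
    have : (fun r : ℝ × (Fin p → ℝ) => Function.update r.2 j r.1) ⁻¹' Set.univ.pi s
        = s j ×ˢ Set.univ.pi (Function.update s j Set.univ) := by
      ext r
      simp only [Set.mem_preimage, Set.mem_pi, Set.mem_univ, true_implies, Set.mem_prod]
      constructor
      · intro h
        refine ⟨by simpa using h j, fun a => ?_⟩
        by_cases ha : a = j
        · subst ha; simp
        · simpa [ha] using h a
      · rintro ⟨h1, h2⟩ a
        by_cases ha : a = j
        · subst ha; simpa using h1
        · simpa [ha] using h2 a
    rw [this, Measure.prod_prod, Measure.pi_pi, ← Finset.mul_prod_erase _ _ (Finset.mem_univ j),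
      ← Finset.mul_prod_erase Finset.univ (fun a => gaussianReal 0 (v a) (s a)) (Finset.mem_univ j)]
    simp only [Function.update_self, measure_univ, one_mul]
    congr 1
    refine Finset.prod_congr rfl fun a ha => ?_
    rw [Function.update_of_ne (Finset.ne_of_mem_erase ha)]
  have h2 := (MeasurePreserving.mk hm h1).prod (MeasurePreserving.id (gaussianReal 0 w))
  have h3 := (measurePreserving_prodAssoc (gaussianReal 0 (v j)) G (gaussianReal 0 w)).symm
  exact (h2.comp h3).map_eq

lemma measurable_update_prod (j : Fin p) :
    Measurable fun r : ℝ × ((Fin p → ℝ) × ℝ) => (Function.update r.2.1 j r.1, r.2.2) :=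
  (measurable_update'.comp (f := fun r : ℝ × ((Fin p → ℝ) × ℝ) => (r.2.1, r.1))
    (by fun_prop)).prodMk (by fun_prop)

/-- Shifting the remaining coordinates by a multiple of the `j`-th one costs at most its expected
squared size: this is the likelihood comparison in a linear regression on the `j`-th coordinate. -/
lemma affinityDefectLE_gaussianBase_shear {𝒵 : Type*} [MeasurableSpace 𝒵]
    (hv : ∀ a, v a ≠ 0) (hw : w ≠ 0) {j : Fin p} {d : Fin p → ℝ} (hd : d j = 0) (d₀ : ℝ)
    {F : (Fin p → ℝ) × ℝ → 𝒵} (hF : Measurable F) :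
    AffinityDefectLE ((gaussianBase v w).map F)
      ((gaussianBase v w).map fun q => F (q.1 + q.1 j • d, q.2 + q.1 j * d₀))
      (v j * (∑ a, d a ^ 2 / (8 * v a) + d₀ ^ 2 / (8 * w))) := by
  set A : ℝ := ∑ a, d a ^ 2 / (8 * v a) + d₀ ^ 2 / (8 * w) with hA
  have hsq : Integrable (fun t : ℝ => t ^ 2) (gaussianReal 0 (v j)) :=
    (memLp_id_gaussianReal 2).integrable_sq
  have hint : Integrable (fun t : ℝ => t ^ 2 * A) (gaussianReal 0 (v j)) := hsq.mul_const A
  have hval : ∫ t, t ^ 2 * A ∂(gaussianReal 0 (v j)) = v j * A := by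
    rw [integral_mul_const]
    congr 1
    have := variance_of_integral_eq_zero (μ := gaussianReal 0 (v j)) (X := fun x => x)
      (by fun_prop) (by simp)
    rw [← this, variance_fun_id_gaussianReal]
  have hmix := AffinityDefectLE.mixture (μ := gaussianReal 0 (v j)) (ν := gaussianBase v w)
    (s := fun t q => (q.1 + t • d, q.2 + t * d₀)) (by unfold Function.uncurry; fun_prop) hint
    (fun t => by
      refine (affinityDefectLE_gaussianBase_shift hv hw (t • d) (t * d₀)).mono (le_of_eq ?_)
      rw [hA, mul_add, Finset.mul_sum]
      congr 1
      · refine Finset.sum_congr rfl fun a _ => ?_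
        simp only [Pi.smul_apply, smul_eq_mul]
        ring
      · ring)
    (hF.comp (measurable_update_prod j))
  have hS : Measurable fun q : (Fin p → ℝ) × ℝ => F (q.1 + q.1 j • d, q.2 + q.1 j * d₀) :=
    hF.comp (by fun_prop)
  have e1 : (gaussianBase v w).map F = ((gaussianReal 0 (v j)).prod (gaussianBase v w)).map
      (F ∘ fun r => (Function.update r.2.1 j r.1, r.2.2)) := by
    rw [← Measure.map_map hF (measurable_update_prod j), gaussianBase_eq_map_update]
  have e2 : (gaussianBase v w).map (fun q => F (q.1 + q.1 j • d, q.2 + q.1 j * d₀))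
      = ((gaussianReal 0 (v j)).prod (gaussianBase v w)).map
      ((fun q => F (q.1 + q.1 j • d, q.2 + q.1 j * d₀)) ∘
        fun r => (Function.update r.2.1 j r.1, r.2.2)) := by
    rw [← Measure.map_map hS (measurable_update_prod j), gaussianBase_eq_map_update]
  rw [e1, e2, ← hval]
  convert hmix using 2
  funext r
  simp only [Function.comp_apply, Function.update_self]
  congr 2
  funext a
  by_cases ha : a = j
  · subst ha; simp [hd]
  · simp [ha]

/-- Centred Gaussian coordinates may be reflected. -/
lemma gaussianBase_map_reflect {𝒵 : Type*} [MeasurableSpace 𝒵] (j : Fin p)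
    {F : (Fin p → ℝ) × ℝ → 𝒵} (hF : Measurable F) :
    (gaussianBase v w).map (fun q => F (Function.update q.1 j (-q.1 j), q.2))
      = (gaussianBase v w).map F := by
  have hm : Measurable fun q : (Fin p → ℝ) × ℝ => (Function.update q.1 j (-q.1 j), q.2) :=
    (measurable_update_prod j).comp (f := fun q : (Fin p → ℝ) × ℝ => (-q.1 j, q)) (by fun_prop)
  have h : (gaussianBase v w).map (fun q => (Function.update q.1 j (-q.1 j), q.2))
      = gaussianBase v w := by
    have hneg : MeasurePreserving (fun t : ℝ => -t) (gaussianReal 0 (v j)) (gaussianReal 0 (v j)) :=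
      ⟨measurable_neg, by rw [gaussianReal_map_neg, neg_zero]⟩
    have h2 := (hneg.prod (MeasurePreserving.id (gaussianBase v w))).map_eq
    conv_lhs => rw [← gaussianBase_eq_map_update (v := v) (w := w) j]
    conv_rhs => rw [← gaussianBase_eq_map_update (v := v) (w := w) j, ← h2]
    rw [Measure.map_map hm (measurable_update_prod j),
      Measure.map_map (measurable_update_prod j) (by fun_prop)]
    congr 1
    funext r
    simp
  have := Measure.map_map hF hm (μ := gaussianBase v w)
  rw [h] at this
  rw [this]
  rfl

end Base

/-! ### Moments of the standard normal law -/

lemma gaussianReal_zero_eq_map_sqrt_mul {q : ℝ} (hq : 0 ≤ q) :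
    gaussianReal 0 q.toNNReal = (gaussianReal 0 1).map (fun x => √q * x) := by
  rw [gaussianReal_map_const_mul, mul_zero, mul_one]
  congr 1
  ext
  simp [hq]

lemma integral_pow_eight_stdNormal : ∫ x, x ^ 8 ∂(gaussianReal 0 1) = 105 := by
  rw [integral_gaussianReal_eq_integral_smul one_ne_zero]
  have h1 : ∀ x : ℝ, gaussianPDFReal 0 1 x • x ^ 8
      = (fun y : ℝ =>
        (√(2 * Real.pi))⁻¹ * (y ^ (8 : ℝ) * Real.exp (-(1 / 2) * y ^ (2 : ℝ)))) |x| := by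
    intro x
    have e8 : |x| ^ (8 : ℝ) = x ^ 8 := by
      rw [show (8 : ℝ) = ((8 : ℕ) : ℝ) by norm_num, Real.rpow_natCast, Even.pow_abs (by decide)]
    have e2 : |x| ^ (2 : ℝ) = x ^ 2 := by
      rw [show (2 : ℝ) = ((2 : ℕ) : ℝ) by norm_num, Real.rpow_natCast, sq_abs]
    simp only [gaussianPDFReal, smul_eq_mul, e8, e2]
    rw [show -(x - 0) ^ 2 / (2 * ((1 : ℝ≥0) : ℝ)) = -(1 / 2) * x ^ 2 by simp; ring]
    simp only [NNReal.coe_one, mul_one]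
    ring
  simp_rw [h1]
  rw [integral_comp_abs (f := fun y : ℝ => (√(2 * Real.pi))⁻¹ *
    (y ^ (8 : ℝ) * Real.exp (-(1 / 2) * y ^ (2 : ℝ)))), integral_const_mul,
    integral_rpow_mul_exp_neg_mul_rpow (by norm_num) (by norm_num) (by norm_num)]
  have hG : Real.Gamma ((8 + 1) / 2) = 105 / 16 * √Real.pi := by
    have := Real.Gamma_nat_add_half 4
    rw [show ((8 : ℝ) + 1) / 2 = ((4 : ℕ) : ℝ) + 1 / 2 by norm_num, this]
    norm_num [Nat.doubleFactorial]
    ring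
  rw [hG]
  have hp : (1 / 2 : ℝ) ^ (-(8 + 1) / 2 : ℝ) = 16 * √2 := by
    rw [one_div, Real.inv_rpow (by norm_num), ← Real.rpow_neg (by norm_num), Real.sqrt_eq_rpow,
      show (-(-(8 + 1) / 2) : ℝ) = ((4 : ℕ) : ℝ) + 1 / 2 by norm_num,
      Real.rpow_add (by norm_num), Real.rpow_natCast]
    norm_num
  rw [hp, Real.sqrt_mul (by norm_num)]
  have := Real.sqrt_pos.2 Real.pi_pos
  field_simp

lemma lintegral_exp_sq_stdNormal_le :
    ∫⁻ x, ENNReal.ofReal (Real.exp (3 / 8 * x ^ 2)) ∂(gaussianReal 0 1) ≤ 2 := by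
  have hm : Measurable fun x : ℝ => ENNReal.ofReal (Real.exp (3 / 8 * x ^ 2)) := by fun_prop
  rw [gaussianReal_of_var_ne_zero _ one_ne_zero,
    lintegral_withDensity_eq_lintegral_mul _ (measurable_gaussianPDF _ _) hm]
  have : ∀ x : ℝ, (gaussianPDF 0 1 * fun x => ENNReal.ofReal (Real.exp (3 / 8 * x ^ 2))) x
      = ENNReal.ofReal 2 * gaussianPDF 0 4 x := by
    intro x
    simp only [Pi.mul_apply, gaussianPDF]
    rw [← ENNReal.ofReal_mul (gaussianPDFReal_nonneg _ _ _), ← ENNReal.ofReal_mul (by norm_num)]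
    congr 1
    simp only [gaussianPDFReal]
    have h4 : √(2 * Real.pi * ((4 : ℝ≥0) : ℝ)) = 2 * √(2 * Real.pi) := by
      rw [show 2 * Real.pi * ((4 : ℝ≥0) : ℝ) = 2 ^ 2 * (2 * Real.pi) by
        push_cast; ring, Real.sqrt_mul (by norm_num), Real.sqrt_sq (by norm_num)]
    rw [h4, mul_assoc, ← Real.exp_add, NNReal.coe_one, mul_one, mul_inv, ← mul_assoc, ← mul_assoc,
      mul_inv_cancel₀ two_ne_zero, one_mul]
    congr 2
    push_cast
    ring
  simp_rw [this]
  rw [lintegral_const_mul _ (measurable_gaussianPDF _ _), lintegral_gaussianPDF_eq_one _ (by simp)]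
  simp

lemma stdNormal_abs_le (t : ℝ) :
    gaussianReal 0 1 {x | |x| ≤ t} ≤ ENNReal.ofReal t := by
  rw [gaussianReal_apply _ one_ne_zero]
  calc ∫⁻ x in {x | |x| ≤ t}, gaussianPDF 0 1 x
      ≤ ∫⁻ _ in {x : ℝ | |x| ≤ t}, ENNReal.ofReal (1 / 2) := by
        refine lintegral_mono fun x => ENNReal.ofReal_le_ofReal ?_
        simp only [gaussianPDFReal, NNReal.coe_one, mul_one]
        have h2 : 2 ≤ √(2 * Real.pi) := Real.le_sqrt_of_sq_le (by nlinarith [Real.pi_gt_three])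
        have h3 : (√(2 * Real.pi))⁻¹ ≤ 1 / 2 := by
          rw [one_div]; exact inv_anti₀ (by norm_num) h2
        have h4 : Real.exp (-(x - 0) ^ 2 / 2) ≤ 1 :=
          Real.exp_le_one_iff.2 (by nlinarith [sq_nonneg x])
        calc _ ≤ 1 / 2 * 1 := mul_le_mul h3 h4 (Real.exp_nonneg _) (by norm_num)
          _ = _ := by norm_num
    _ = ENNReal.ofReal t := by
        have : {x : ℝ | |x| ≤ t} = Set.Icc (-t) t := by ext; simp [abs_le]
        rw [setLIntegral_const, this, Real.volume_Icc, ← ENNReal.ofReal_mul (by norm_num)]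
        congr 1; ring

/-! ### Gaussian mechanisms -/

section Mechanism

variable {p : ℕ}

/-- The variance of `⟨T g, θ⟩` when the coordinates of `g` are independent with variances `v a`. -/
noncomputable def quadForm (v : Fin p → ℝ≥0) (T : (Fin p → ℝ) →L[ℝ] EuclideanSpace ℝ (Fin p))
    (θ : EuclideanSpace ℝ (Fin p)) : ℝ :=
  ∑ a, v a * inner ℝ (T (Pi.single a 1)) θ ^ 2

lemma quadForm_nonneg (v : Fin p → ℝ≥0) (T : (Fin p → ℝ) →L[ℝ] EuclideanSpace ℝ (Fin p))
    (θ : EuclideanSpace ℝ (Fin p)) : 0 ≤ quadForm v T θ :=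
  Finset.sum_nonneg fun a _ => by positivity

lemma map_sum_mul_pi_gaussianReal (v : Fin p → ℝ≥0) (c : Fin p → ℝ) :
    (Measure.pi fun a => gaussianReal 0 (v a)).map (fun g => ∑ a, c a * g a)
      = gaussianReal 0 (∑ a, v a * c a ^ 2).toNNReal := by
  apply Measure.ext_of_charFun
  ext t
  rw [charFun_gaussianReal, charFun_apply_real,
    integral_map (Measurable.aemeasurable (by fun_prop)) (by fun_prop)]
  have : ∀ g : Fin p → ℝ, Complex.exp (t * ((∑ a, c a * g a : ℝ) : ℂ) * Complex.I)
      = ∏ a, Complex.exp ((t * c a : ℝ) * (g a : ℂ) * Complex.I) := by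
    intro g
    rw [← Complex.exp_sum]
    congr 1
    push_cast
    rw [Finset.mul_sum, Finset.sum_mul]
    exact Finset.sum_congr rfl fun a _ => by ring
  simp_rw [this]
  rw [integral_fintype_prod_eq_prod (f := fun a (x : ℝ) =>
    Complex.exp ((t * c a : ℝ) * (x : ℂ) * Complex.I))]
  simp_rw [← charFun_apply_real, charFun_gaussianReal, ← Complex.exp_sum]
  congr 1
  rw [Real.coe_toNNReal _ (Finset.sum_nonneg fun a _ => by positivity)]
  push_cast
  simp only [mul_zero, zero_mul, zero_sub]
  rw [Finset.sum_neg_distrib, Finset.sum_mul, Finset.sum_div]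
  congr 1
  exact Finset.sum_congr rfl fun a _ => by ring

/-- The covariate law of `T g`, where `g` has independent centred Gaussian coordinates with
variances `v a`. -/
noncomputable def covLaw (v : Fin p → ℝ≥0) (T : (Fin p → ℝ) →L[ℝ] EuclideanSpace ℝ (Fin p)) :
    Measure (EuclideanSpace ℝ (Fin p)) :=
  (Measure.pi fun a => gaussianReal 0 (v a)).map T

variable (v : Fin p → ℝ≥0) (T : (Fin p → ℝ) →L[ℝ] EuclideanSpace ℝ (Fin p))

instance : IsProbabilityMeasure (covLaw v T) := Measure.isProbabilityMeasure_map (by fun_prop)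

lemma map_inner_covLaw (θ : EuclideanSpace ℝ (Fin p)) :
    (covLaw v T).map (fun x => inner ℝ x θ) = gaussianReal 0 (quadForm v T θ).toNNReal := by
  rw [covLaw, Measure.map_map (by fun_prop) (by fun_prop), quadForm,
    ← map_sum_mul_pi_gaussianReal]
  congr 1
  funext g
  have hg : g = ∑ a, g a • Pi.single (M := fun _ => ℝ) a 1 := by
    conv_lhs => rw [← Finset.univ_sum_single g]
    refine Finset.sum_congr rfl fun a _ => ?_
    rw [← Pi.single_smul]; simp
  simp only [Function.comp_apply]
  conv_lhs => rw [hg, map_sum, sum_inner]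
  refine Finset.sum_congr rfl fun a _ => ?_
  rw [map_smul, inner_smul_left]
  simp [mul_comm]

lemma memLp_coord_covLaw (a : Fin p) : MemLp (fun x => x a) 2 (covLaw v T) := by
  have h := map_inner_covLaw v T (EuclideanSpace.single a 1)
  have h2 : MemLp id 2 ((covLaw v T).map fun x => inner ℝ x (EuclideanSpace.single a (1 : ℝ))) := by
    rw [h]; exact memLp_id_gaussianReal 2
  rw [memLp_map_measure_iff (by fun_prop) (by fun_prop)] at h2
  simpa [Function.comp_def, EuclideanSpace.inner_single_right] using h2

lemma memLp_covLaw : MemLp (fun x => x) 2 (covLaw v T) :=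
  MemLp.of_eval_piLp (memLp_coord_covLaw v T)

lemma sum_mul_integral_mul_covLaw (θ : EuclideanSpace ℝ (Fin p)) :
    dotProduct (fun a => θ a)
      ((Matrix.of fun a b => ∫ x, x a * x b ∂(covLaw v T)).mulVec fun a => θ a)
      = quadForm v T θ := by
  have h := map_inner_covLaw v T θ
  have hint : ∀ a b, Integrable (fun x : EuclideanSpace ℝ (Fin p) => x a * x b) (covLaw v T) :=
    fun a b => (memLp_coord_covLaw v T a).integrable_mul (memLp_coord_covLaw v T b)
  have h1 : ∫ y, y ^ 2 ∂((covLaw v T).map fun x => inner ℝ x θ) = quadForm v T θ := by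
    rw [h]
    have := variance_of_integral_eq_zero (μ := gaussianReal 0 (quadForm v T θ).toNNReal)
      (X := fun x => x) (by fun_prop) (by simp)
    rw [← this, variance_fun_id_gaussianReal, Real.coe_toNNReal _ (quadForm_nonneg v T θ)]
  rw [← h1, integral_map (by fun_prop) (by fun_prop)]
  have : ∀ x : EuclideanSpace ℝ (Fin p), (inner ℝ x θ : ℝ) ^ 2
      = ∑ a, ∑ b, θ a * θ b * (x a * x b) := by
    intro x
    rw [PiLp.inner_apply, sq, Finset.sum_mul_sum]
    refine Finset.sum_congr rfl fun a _ => Finset.sum_congr rfl fun b _ => ?_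
    simp; ring
  simp_rw [this]
  rw [integral_finsetSum _ fun a _ => integrable_finsetSum _ fun b _ => (hint a b).const_mul _]
  simp_rw [dotProduct, Matrix.mulVec, dotProduct, Finset.mul_sum]
  refine Finset.sum_congr rfl fun a _ => ?_
  rw [integral_finsetSum _ fun b _ => (hint a b).const_mul _]
  refine Finset.sum_congr rfl fun b _ => ?_
  rw [integral_const_mul]
  simp only [Matrix.of_apply]
  ring

lemma condExp_snd_prod {Ω : Type*} [MeasurableSpace Ω] (μ : Measure Ω) [IsProbabilityMeasure μ]
    (ν : Measure ℝ) [IsProbabilityMeasure ν] {f : ℝ → ℝ} (hf : Measurable f) :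
    condExp (MeasurableSpace.comap Prod.fst inferInstance) (μ.prod ν) (fun ω : Ω × ℝ => f ω.2)
      =ᵐ[μ.prod ν] fun _ => ∫ y, f y ∂ν := by
  have hi : Indep (MeasurableSpace.comap Prod.snd inferInstance)
      (MeasurableSpace.comap Prod.fst inferInstance) (μ.prod ν) :=
    (indepFun_prod (X := fun x : Ω => x) (Y := fun y : ℝ => y) measurable_id measurable_id).symm
  refine (condExp_indep_eq measurable_snd.comap_le measurable_fst.comap_le
    (hf.comp (comap_measurable Prod.snd)).stronglyMeasurable hi).trans ?_
  simp only [Function.comp_def]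
  rw [integral_fun_snd f]
  simp

lemma integral_sq_gaussianReal (w : ℝ≥0) : ∫ y, y ^ 2 ∂(gaussianReal 0 w) = w := by
  have := variance_of_integral_eq_zero (μ := gaussianReal 0 w) (X := fun x => x)
    (by fun_prop) (by simp)
  rw [← this, variance_fun_id_gaussianReal]

/-- The mechanism with covariates `T g`, where `g` has independent centred Gaussian coordinates with
variances `v a`, and with independent centred Gaussian noise of standard deviation `σ`. -/
noncomputable def gaussianMechanism (β : EuclideanSpace ℝ (Fin p)) (σ : ℝ) (hσ : 0 ≤ σ) :
    Mechanism p where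
  law := (covLaw v T).prod (gaussianReal 0 (σ ^ 2).toNNReal)
  isProbabilityMeasure := inferInstance
  beta := β
  sigma := σ
  sigma_nonneg := hσ
  memLp_covariate := (memLp_covLaw v T).comp_fst _
  memLp_noise := (memLp_id_gaussianReal 2).comp_snd _
  condExp_noise := by
    refine (condExp_snd_prod _ _ measurable_id).trans ?_
    simp only [id_eq, integral_id_gaussianReal]
    rfl
  condVar_noise := by
    rw [condVar]
    refine (condExp_congr_ae (g := fun ω => ω.2 ^ 2) ?_).trans
      ((condExp_snd_prod _ _ (f := fun y => y ^ 2) (by fun_prop)).trans ?_)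
    · filter_upwards [condExp_snd_prod (covLaw v T) (gaussianReal 0 (σ ^ 2).toNNReal)
        measurable_id] with ω hω
      simp only [id_eq, integral_id_gaussianReal] at hω
      simp [hω]
    · rw [integral_sq_gaussianReal, Real.coe_toNNReal _ (sq_nonneg σ)]

variable (β : EuclideanSpace ℝ (Fin p)) {σ : ℝ} (hσ : 0 ≤ σ)

lemma gaussianMechanism_covariateLaw :
    (gaussianMechanism v T β σ hσ).covariateLaw
      = (gaussianBase v (σ ^ 2).toNNReal).map (fun q => T q.1) := by
  have h1 : (gaussianMechanism v T β σ hσ).covariateLaw = covLaw v T := by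
    simp [Mechanism.covariateLaw, gaussianMechanism]
  have h2 : (gaussianBase v (σ ^ 2).toNNReal).map Prod.fst
      = Measure.pi fun a => gaussianReal 0 (v a) := by
    simp [gaussianBase]
  rw [h1, covLaw, ← h2, Measure.map_map (by fun_prop) (by fun_prop)]
  rfl

lemma gaussianMechanism_observedLaw (O : Finset (Fin p)) :
    (gaussianMechanism v T β σ hσ).observedLaw O = (gaussianBase v (σ ^ 2).toNNReal).map
      (fun q => (fun a : O => T q.1 a, inner ℝ (T q.1) β + q.2)) := by
  have h1 : (gaussianMechanism v T β σ hσ).law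
      = (gaussianBase v (σ ^ 2).toNNReal).map (Prod.map T id) := by
    rw [gaussianBase, ← Measure.map_prod_map _ _ (by fun_prop) (by fun_prop), Measure.map_id]
    rfl
  have h2 : Measurable fun ω : EuclideanSpace ℝ (Fin p) × ℝ =>
      ((fun a : O => ω.1 a), inner ℝ ω.1 β + ω.2) := by fun_prop
  rw [Mechanism.observedLaw, h1]
  exact Measure.map_map h2 (by fun_prop)

lemma gaussianMechanism_map_inner (θ : EuclideanSpace ℝ (Fin p)) :
    (gaussianMechanism v T β σ hσ).law.map (fun ω => inner ℝ ω.1 θ)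
      = (gaussianReal 0 1).map (fun x => √(quadForm v T θ) * x) := by
  rw [← gaussianReal_zero_eq_map_sqrt_mul (quadForm_nonneg v T θ), ← map_inner_covLaw]
  have : (gaussianMechanism v T β σ hσ).law.map Prod.fst = covLaw v T := by
    simp [gaussianMechanism]
  rw [← this, Measure.map_map (by fun_prop) (by fun_prop)]
  rfl

lemma gaussianMechanism_secondMoment :
    (gaussianMechanism v T β σ hσ).secondMoment
      = Matrix.of fun a b => ∫ x, x a * x b ∂(covLaw v T) := by
  ext a b
  simp only [Mechanism.secondMoment, Matrix.of_apply, gaussianMechanism]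
  rw [integral_fun_fst (fun x : EuclideanSpace ℝ (Fin p) => x a * x b)]
  simp

lemma gaussianMechanism_dotProduct (θ : EuclideanSpace ℝ (Fin p)) :
    dotProduct (fun a => θ a)
      ((gaussianMechanism v T β σ hσ).secondMoment.mulVec fun a => θ a) = quadForm v T θ := by
  rw [gaussianMechanism_secondMoment, sum_mul_integral_mul_covLaw]

lemma gaussianMechanism_isHermitian :
    (gaussianMechanism v T β σ hσ).secondMoment.IsHermitian := by
  ext a b
  simp [Mechanism.secondMoment, mul_comm]

lemma gaussianMechanism_posSemidef :
    (gaussianMechanism v T β σ hσ).secondMoment.PosSemidef := by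
  refine Matrix.PosSemidef.of_dotProduct_mulVec_nonneg
    (gaussianMechanism_isHermitian v T β hσ) fun x => ?_
  have := gaussianMechanism_dotProduct v T β hσ (WithLp.toLp 2 x)
  simp only at this
  simp only [star_trivial]
  rw [this]
  exact quadForm_nonneg _ _ _

lemma covLaw_eq_multivariateGaussian :
    covLaw v T = multivariateGaussian 0 (gaussianMechanism v T β σ hσ).secondMoment := by
  apply Measure.ext_of_charFun
  ext θ
  rw [charFun_multivariateGaussian (gaussianMechanism_posSemidef v T β hσ),
    gaussianMechanism_dotProduct, charFun_apply]
  have h : ∫ x, Complex.exp ((inner ℝ x θ : ℝ) * Complex.I) ∂(covLaw v T)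
      = charFun ((covLaw v T).map fun x => inner ℝ x θ) 1 := by
    rw [charFun_apply_real, integral_map (by fun_prop) (by fun_prop)]
    simp
  rw [h, map_inner_covLaw, charFun_gaussianReal, Real.coe_toNNReal _ (quadForm_nonneg v T θ)]
  simp

lemma gaussianMechanism_isGaussianModel :
    (gaussianMechanism v T β σ hσ).IsGaussianModel := by
  refine ⟨?_, ?_, ?_⟩
  · rw [← covLaw_eq_multivariateGaussian]
    simp [Mechanism.covariateLaw, gaussianMechanism]
  · simp [gaussianMechanism]
  · exact (indepFun_prod (X := fun x : EuclideanSpace ℝ (Fin p) => x) (Y := fun y : ℝ => y)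
      measurable_id measurable_id).symm

lemma gaussianMechanism_smallBall {χ C : ℝ} (hχ : 0 < χ) (hχ1 : χ ≤ 1) (hC : 1 ≤ C)
    (hq : ∀ θ : EuclideanSpace ℝ (Fin p), θ ≠ 0 → 0 < quadForm v T θ) :
    (gaussianMechanism v T β σ hσ).SmallBall χ C := by
  intro θ hθ t ht
  rw [gaussianMechanism_dotProduct]
  have hs : 0 < √(quadForm v T θ) := Real.sqrt_pos.2 (hq θ hθ)
  have hP := (gaussianMechanism v T β σ hσ).isProbabilityMeasure
  set A : Set ℝ := {x | |x| ≤ t * √(quadForm v T θ)} with hA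
  have hAm : MeasurableSet A := measurableSet_le (by fun_prop) (by fun_prop)
  have e1 : (gaussianMechanism v T β σ hσ).law {ω | |(inner ℝ ω.1 θ : ℝ)| ≤
      t * √(quadForm v T θ)} ≤ ENNReal.ofReal t := by
    have : (gaussianMechanism v T β σ hσ).law {ω | |(inner ℝ ω.1 θ : ℝ)| ≤
      t * √(quadForm v T θ)} = (gaussianMechanism v T β σ hσ).law.map
        (fun ω => inner ℝ ω.1 θ) A := by
      rw [Measure.map_apply (by fun_prop) hAm]; rfl
    rw [this, gaussianMechanism_map_inner, Measure.map_apply (by fun_prop) hAm]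
    refine le_trans (le_of_eq ?_) (stdNormal_abs_le t)
    congr 1
    ext x
    simp only [hA, Set.mem_preimage, Set.mem_ofPred_eq, abs_mul, abs_of_pos hs]
    rw [mul_comm, mul_le_mul_iff_of_pos_right hs]
  by_cases h1 : 1 ≤ C * t
  · exact measureReal_le_one.trans (Real.one_le_rpow h1 hχ.le)
  · have h2 : t ≤ C * t := by nlinarith
    calc _ ≤ t := ENNReal.toReal_le_of_le_ofReal ht.le e1
      _ ≤ (C * t) ^ (1 : ℝ) := by rwa [Real.rpow_one]
      _ ≤ _ := Real.rpow_le_rpow_of_exponent_ge (by positivity) (by linarith) hχ1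

lemma gaussianMechanism_subGaussian {lp CX : ℝ} (hlp : 0 < lp) (hCX : √(8 * lp / 3) ≤ CX)
    (hq : ∀ θ : EuclideanSpace ℝ (Fin p), quadForm v T θ ≤ lp * ‖θ‖ ^ 2) :
    (gaussianMechanism v T β σ hσ).SubGaussian CX := by
  refine iSup₂_le fun u hu => ?_
  refine le_trans ?_ (ENNReal.ofReal_le_ofReal hCX)
  have ht : 0 < √(8 * lp / 3) := Real.sqrt_pos.2 (by positivity)
  refine iInf_le_of_le (√(8 * lp / 3)) (iInf_le_of_le ht (iInf_le_of_le ?_ le_rfl))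
  rw [Real.sq_sqrt (by positivity)]
  have hm : Measurable fun y : ℝ => ENNReal.ofReal (Real.exp (y ^ 2 / (8 * lp / 3))) := by fun_prop
  calc ∫⁻ ω, ENNReal.ofReal (Real.exp ((inner ℝ ω.1 u : ℝ) ^ 2 / (8 * lp / 3)))
        ∂(gaussianMechanism v T β σ hσ).law
      = ∫⁻ x, ENNReal.ofReal (Real.exp ((√(quadForm v T u) * x) ^ 2 / (8 * lp / 3)))
        ∂(gaussianReal 0 1) := by
        rw [← lintegral_map (f := fun y : ℝ => ENNReal.ofReal (Real.exp (y ^ 2 / (8 * lp / 3))))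
          (g := fun ω : EuclideanSpace ℝ (Fin p) × ℝ => (inner ℝ ω.1 u : ℝ)) hm (by fun_prop),
          gaussianMechanism_map_inner, lintegral_map hm (by fun_prop)]
    _ ≤ ∫⁻ x, ENNReal.ofReal (Real.exp (3 / 8 * x ^ 2)) ∂(gaussianReal 0 1) := by
        refine lintegral_mono fun x => ENNReal.ofReal_le_ofReal (Real.exp_le_exp.2 ?_)
        rw [mul_pow, Real.sq_sqrt (quadForm_nonneg _ _ _), div_le_iff₀ (by positivity)]
        have := hq u
        rw [hu] at this
        nlinarith [sq_nonneg x]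
    _ ≤ 2 := lintegral_exp_sq_stdNormal_le

lemma gaussianMechanism_eigenBounds {lm lp : ℝ}
    (hl : ∀ θ : EuclideanSpace ℝ (Fin p), lm * ‖θ‖ ^ 2 ≤ quadForm v T θ)
    (hq : ∀ θ : EuclideanSpace ℝ (Fin p), quadForm v T θ ≤ lp * ‖θ‖ ^ 2) :
    (gaussianMechanism v T β σ hσ).EigenBounds lm lp := by
  intro l hlam
  rw [← Matrix.spectrum_toLin', ← Module.End.hasEigenvalue_iff_mem_spectrum] at hlam
  obtain ⟨x, hx, hx0⟩ := hlam.exists_hasEigenvector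
  rw [Module.End.mem_eigenspace_iff, Matrix.toLin'_apply] at hx
  have h := gaussianMechanism_dotProduct v T β hσ (WithLp.toLp 2 x)
  simp only at h
  rw [hx, dotProduct_smul, smul_eq_mul] at h
  have hn : dotProduct x x = ‖WithLp.toLp 2 x‖ ^ 2 := by
    rw [EuclideanSpace.real_norm_sq_eq, dotProduct]
    exact Finset.sum_congr rfl fun a _ => (sq _).symm
  rw [hn] at h
  have hpos : 0 < ‖WithLp.toLp 2 x‖ ^ 2 := by
    have : WithLp.toLp 2 x ≠ 0 := fun h0 => hx0 (by simpa using congrArg WithLp.ofLp h0)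
    positivity
  have h1 := hl (WithLp.toLp 2 x)
  have h2 := hq (WithLp.toLp 2 x)
  rw [← h] at h1 h2
  exact ⟨le_of_mul_le_mul_right h1 hpos, le_of_mul_le_mul_right h2 hpos⟩

lemma gaussianMechanism_noiseMoment {κ : ℝ} (hκ : (105 : ℝ) ^ (1 / 4 : ℝ) ≤ κ) :
    (gaussianMechanism v T β σ hσ).NoiseMoment κ := by
  have hi : Integrable (fun y : ℝ => y ^ 8) (gaussianReal 0 (σ ^ 2).toNNReal) := by
    have := (memLp_id_gaussianReal (μ := 0) (v := (σ ^ 2).toNNReal) 8).integrable_norm_pow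
      (by norm_num)
    simpa [Even.pow_abs (show Even 8 by decide)] using this
  refine ⟨hi.comp_snd _, ?_⟩
  have e : ∫ ω, ω.2 ^ 8 ∂(gaussianMechanism v T β σ hσ).law = 105 * (σ ^ 2) ^ (4 : ℝ) := by
    simp only [gaussianMechanism]
    rw [integral_fun_snd (fun y : ℝ => y ^ 8), gaussianReal_zero_eq_map_sqrt_mul (sq_nonneg σ),
      integral_map (by fun_prop) (by fun_prop)]
    simp_rw [mul_pow]
    rw [integral_const_mul, integral_pow_eight_stdNormal, Real.sqrt_sq hσ]
    rw [show (4 : ℝ) = ((4 : ℕ) : ℝ) by norm_num, Real.rpow_natCast]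
    simp
    ring
  rw [e, Real.mul_rpow (by norm_num) (by positivity), ← Real.rpow_mul (sq_nonneg σ)]
  norm_num
  exact mul_le_mul_of_nonneg_right (by simpa using hκ) (sq_nonneg σ)

lemma gaussianMechanism_mem_classOSSGauss {χ C CX lm lp R B κ : ℝ} (hχ : 0 < χ) (hχ1 : χ ≤ 1)
    (hC : 1 ≤ C) (hlm : 0 < lm) (hlp : 0 < lp) (hCX : √(8 * lp / 3) ≤ CX)
    (hκ : (105 : ℝ) ^ (1 / 4 : ℝ) ≤ κ)
    (hl : ∀ θ : EuclideanSpace ℝ (Fin p), lm * ‖θ‖ ^ 2 ≤ quadForm v T θ)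
    (hq : ∀ θ : EuclideanSpace ℝ (Fin p), quadForm v T θ ≤ lp * ‖θ‖ ^ 2)
    (hβ : ‖β‖ ≤ B) (hσR : σ ≤ R) :
    gaussianMechanism v T β σ hσ ∈ classOSSGauss p χ C CX lm lp R B κ := by
  refine ⟨⟨gaussianMechanism_smallBall v T β hσ hχ hχ1 hC fun θ hθ => ?_,
    gaussianMechanism_subGaussian v T β hσ hlp hCX hq,
    gaussianMechanism_eigenBounds v T β hσ hl hq, hβ, hσR,
    gaussianMechanism_noiseMoment v T β hσ hκ⟩, gaussianMechanism_isGaussianModel v T β hσ⟩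
  refine lt_of_lt_of_le ?_ (hl θ)
  have := norm_pos_iff.2 hθ
  positivity

end Mechanism

/-! ### Assouad's lemma for the minimax risk -/

section Assouad

variable {p K : ℕ} {O : Fin K → Finset (Fin p)} {n : Fin K → ℕ} {N : ℕ}

instance (P : Mechanism p) : IsProbabilityMeasure P.covariateLaw := by
  have := P.isProbabilityMeasure
  exact Measure.isProbabilityMeasure_map (by fun_prop)

instance (P : Mechanism p) (O : Finset (Fin p)) : IsProbabilityMeasure (P.observedLaw O) := by
  have := P.isProbabilityMeasure
  refine Measure.isProbabilityMeasure_map (Measurable.aemeasurable ?_)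
  unfold Mechanism.response
  fun_prop

instance (P : Mechanism p) : IsProbabilityMeasure (dataLaw O n N P) := by
  unfold dataLaw; infer_instance

/-- The affinity defect of the data is at most the sum of those of the observations. -/
lemma affinityDefectLE_dataLaw {P Q : Mechanism p} {e : Fin K → ℝ} {e₀ : ℝ}
    (h : ∀ k, AffinityDefectLE (P.observedLaw (O k)) (Q.observedLaw (O k)) (e k))
    (h₀ : AffinityDefectLE P.covariateLaw Q.covariateLaw e₀) (he : ∀ k, 0 ≤ e k) (he₀ : 0 ≤ e₀) :
    AffinityDefectLE (dataLaw O n N P) (dataLaw O n N Q) (∑ k, n k * e k + N * e₀) := by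
  have h1 : ∀ k, AffinityDefectLE (Measure.pi fun _ : Fin (n k) => P.observedLaw (O k))
      (Measure.pi fun _ : Fin (n k) => Q.observedLaw (O k)) (n k * e k) := fun k => by
    simpa using AffinityDefectLE.pi_fin (fun _ : Fin (n k) => h k) (fun _ => he k)
  have h2 : AffinityDefectLE (Measure.pi fun _ : Fin N => P.covariateLaw)
      (Measure.pi fun _ : Fin N => Q.covariateLaw) (N * e₀) := by
    simpa using AffinityDefectLE.pi_fin (fun _ : Fin N => h₀) (fun _ => he₀)
  have hn : ∀ k, 0 ≤ n k * e k := fun k => mul_nonneg (by positivity) (he k)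
  exact (AffinityDefectLE.pi_fin h1 hn).prod h2 (Finset.sum_nonneg fun k _ => hn k) (by positivity)

/-- The sign `±1` encoded by a Boolean. -/
def boolSign (b : Bool) : ℝ := if b then 1 else -1

@[simp] lemma boolSign_not (b : Bool) : boolSign (!b) = -boolSign b := by
  cases b <;> simp [boolSign]

@[simp] lemma boolSign_sq (b : Bool) : boolSign b ^ 2 = 1 := by cases b <;> simp [boolSign]

/-- Flip the `j`-th sign. -/
def flipAt (j : Fin p) (τ : Fin p → Bool) : Fin p → Bool := Function.update τ j (!τ j)

@[simp] lemma flipAt_self (j : Fin p) (τ : Fin p → Bool) : flipAt j τ j = !τ j := by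
  simp [flipAt]

lemma flipAt_of_ne {a j : Fin p} (h : a ≠ j) (τ : Fin p → Bool) : flipAt j τ a = τ a := by
  simp [flipAt, h]

lemma flipAt_involutive (j : Fin p) : Function.Involutive (flipAt j) := by
  intro τ
  funext a
  by_cases h : a = j
  · subst h; simp
  · simp [flipAt_of_ne h]

/-- The two-point bound for the estimation of a real parameter known to be `t` or `-t`. -/
lemma AffinityDefectLE.sq_loss {𝒳 : Type*} [MeasurableSpace 𝒳] {P Q : Measure 𝒳}
    [IsProbabilityMeasure P] [IsProbabilityMeasure Q] (h : AffinityDefectLE P Q (1 / 2))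
    {b : 𝒳 → ℝ} (hb : Measurable b) (t : ℝ) :
    ENNReal.ofReal (t ^ 2 / 16) ≤ ∫⁻ x, ENNReal.ofReal ((b x - t) ^ 2) ∂P
      + ∫⁻ x, ENNReal.ofReal ((b x - -t) ^ 2) ∂Q := by
  by_cases ht : t = 0
  · simp [ht]
  have ht2 : 0 < t ^ 2 := by positivity
  have key := h.one_div_sixteen_le (f := fun x => ENNReal.ofReal ((t ^ 2)⁻¹ * (b x - t) ^ 2))
    (g := fun x => ENNReal.ofReal ((t ^ 2)⁻¹ * (b x - -t) ^ 2)) (by fun_prop) (by fun_prop)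
    (fun x => by
      rw [← ENNReal.ofReal_add (by positivity) (by positivity), ← ENNReal.ofReal_one]
      refine ENNReal.ofReal_le_ofReal ?_
      rw [← mul_add, ← div_eq_inv_mul, le_div_iff₀ ht2]
      nlinarith [sq_nonneg (b x)])
  simp_rw [ENNReal.ofReal_mul (inv_nonneg.2 ht2.le)] at key
  rw [lintegral_const_mul _ (by fun_prop), lintegral_const_mul _ (by fun_prop), ← mul_add] at key
  calc ENNReal.ofReal (t ^ 2 / 16) = ENNReal.ofReal (t ^ 2) * (1 / 16) := by
        rw [ENNReal.ofReal_div_of_pos (by norm_num), one_div, ENNReal.div_eq_inv_mul, mul_comm]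
        simp
    _ ≤ ENNReal.ofReal (t ^ 2) * (ENNReal.ofReal (t ^ 2)⁻¹ * _) := by gcongr
    _ = _ := by
        rw [← mul_assoc, ← ENNReal.ofReal_mul ht2.le, mul_inv_cancel₀ ht2.ne', ENNReal.ofReal_one,
          one_mul]

/-- Assouad's lemma: if neighbouring vertices of a hypercube of probability measures cannot be told
apart, and the parameters with index in `S` are `±d a`, then the squared risk of any estimator is at
least a constant times `∑ d a ^ 2` at some vertex. -/
theorem assouad {𝒳 : Type*} [MeasurableSpace 𝒳] (D : (Fin p → Bool) → Measure 𝒳)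
    [∀ τ, IsProbabilityMeasure (D τ)] (β : (Fin p → Bool) → EuclideanSpace ℝ (Fin p))
    {b : 𝒳 → EuclideanSpace ℝ (Fin p)} (hb : ∀ j, Measurable fun x => b x j)
    (S : Finset (Fin p)) (d : Fin p → ℝ)
    (hβ : ∀ τ, ∀ a ∈ S, β τ a = boolSign (τ a) * d a)
    (haff : ∀ τ, ∀ j ∈ S, AffinityDefectLE (D τ) (D (flipAt j τ)) (1 / 2)) {M : ℝ≥0∞}
    (hM : ∀ τ, ∫⁻ x, ENNReal.ofReal (‖b x - β τ‖ ^ 2) ∂(D τ) ≤ M) :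
    ENNReal.ofReal (1 / 32 * ∑ a ∈ S, d a ^ 2) ≤ M := by
  set r : Fin p → (Fin p → Bool) → ℝ≥0∞ := fun j τ =>
    ∫⁻ x, ENNReal.ofReal ((b x j - β τ j) ^ 2) ∂(D τ) with hr
  have h1 : ∀ τ, ∑ j ∈ S, r j τ ≤ M := by
    intro τ
    calc ∑ j ∈ S, r j τ
        = ∫⁻ x, ∑ j ∈ S, ENNReal.ofReal ((b x j - β τ j) ^ 2) ∂(D τ) :=
          (lintegral_finsetSum _ fun j _ =>
            (((hb j).sub_const _).pow_const 2).ennreal_ofReal).symm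
      _ ≤ ∫⁻ x, ENNReal.ofReal (‖b x - β τ‖ ^ 2) ∂(D τ) := by
          refine lintegral_mono fun x => ?_
          rw [← ENNReal.ofReal_sum_of_nonneg fun _ _ => sq_nonneg _, EuclideanSpace.real_norm_sq_eq]
          refine ENNReal.ofReal_le_ofReal ?_
          exact Finset.sum_le_sum_of_subset_of_nonneg (Finset.subset_univ S)
            fun _ _ _ => sq_nonneg _
      _ ≤ M := hM τ
  have h2 : ∀ j ∈ S, ∀ τ, ENNReal.ofReal (d j ^ 2 / 16) ≤ r j τ + r j (flipAt j τ) := by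
    intro j hj τ
    have := (haff τ j hj).sq_loss (hb j) (boolSign (τ j) * d j)
    rw [mul_pow, boolSign_sq, one_mul] at this
    simp only [hr]
    rw [hβ _ j hj, hβ _ j hj, flipAt_self, boolSign_not, neg_mul]
    exact this
  have h3 : ∀ j ∈ S, (Fintype.card (Fin p → Bool) : ℝ≥0∞) * ENNReal.ofReal (d j ^ 2 / 16)
      ≤ 2 * ∑ τ, r j τ := by
    intro j hj
    calc (Fintype.card (Fin p → Bool) : ℝ≥0∞) * ENNReal.ofReal (d j ^ 2 / 16)
        = ∑ _τ : Fin p → Bool, ENNReal.ofReal (d j ^ 2 / 16) := by simp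
      _ ≤ ∑ τ, (r j τ + r j (flipAt j τ)) := Finset.sum_le_sum fun τ _ => h2 j hj τ
      _ = 2 * ∑ τ, r j τ := by
        rw [Finset.sum_add_distrib, two_mul]
        congr 1
        exact Equiv.sum_comp (flipAt_involutive j).toPerm (r j)
  have h4 : (Fintype.card (Fin p → Bool) : ℝ≥0∞) * ENNReal.ofReal (∑ j ∈ S, d j ^ 2 / 16)
      ≤ (Fintype.card (Fin p → Bool) : ℝ≥0∞) * (2 * M) := by
    rw [ENNReal.ofReal_sum_of_nonneg fun _ _ => by positivity, Finset.mul_sum]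
    calc _ ≤ ∑ j ∈ S, 2 * ∑ τ, r j τ := Finset.sum_le_sum h3
      _ = 2 * ∑ τ, ∑ j ∈ S, r j τ := by rw [← Finset.mul_sum, Finset.sum_comm]
      _ ≤ 2 * ∑ _τ : Fin p → Bool, M := by gcongr with τ; exact h1 τ
      _ = _ := by simp; ring
  have h5 := (ENNReal.mul_le_mul_iff_right (by simp) (by simp)).1 h4
  calc ENNReal.ofReal (1 / 32 * ∑ a ∈ S, d a ^ 2)
      = ENNReal.ofReal (1 / 2) * ENNReal.ofReal (∑ j ∈ S, d j ^ 2 / 16) := by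
        rw [← ENNReal.ofReal_mul (by norm_num), ← Finset.sum_div]
        congr 1; ring
    _ ≤ ENNReal.ofReal (1 / 2) * (2 * M) := by gcongr
    _ = M := by
        rw [← mul_assoc, show (2 : ℝ≥0∞) = ENNReal.ofReal 2 by simp,
          ← ENNReal.ofReal_mul (by norm_num)]
        norm_num

variable {χ C CX lm lp R B κ : ℝ}

/-- The identification of `Fin p → ℝ` with Euclidean space. -/
noncomputable def idMap (p : ℕ) : (Fin p → ℝ) →L[ℝ] EuclideanSpace ℝ (Fin p) :=
  (PiLp.continuousLinearEquiv 2 ℝ fun _ : Fin p => ℝ).symm.toContinuousLinearMap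

@[simp] lemma idMap_apply (g : Fin p → ℝ) (a : Fin p) : idMap p g a = g a := rfl

lemma quadForm_const_idMap (l : ℝ≥0) (θ : EuclideanSpace ℝ (Fin p)) :
    quadForm (fun _ => l) (idMap p) θ = l * ‖θ‖ ^ 2 := by
  rw [quadForm, EuclideanSpace.real_norm_sq_eq, Finset.mul_sum]
  refine Finset.sum_congr rfl fun a _ => ?_
  rw [PiLp.inner_apply]
  simp [Pi.single_apply]

lemma isotropic_mem_classOSSGauss (hR : 0 < R) (hlm : 0 < lm) (hlmp : lm < lp)
    (hχ : 0 < χ) (hχ1 : χ ≤ 1) (hC : 1 ≤ C) (hCX : √(8 * lp / 3) ≤ CX)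
    (hκ : (105 : ℝ) ^ (1 / 4 : ℝ) ≤ κ) {β : EuclideanSpace ℝ (Fin p)} (hβ : ‖β‖ ≤ B) :
    gaussianMechanism (fun _ => lm.toNNReal) (idMap p) β R hR.le
      ∈ classOSSGauss p χ C CX lm lp R B κ := by
  refine gaussianMechanism_mem_classOSSGauss _ _ _ _ hχ hχ1 hC hlm (hlm.trans hlmp) hCX hκ
    (fun θ => ?_) (fun θ => ?_) hβ le_rfl
  · rw [quadForm_const_idMap, Real.coe_toNNReal _ hlm.le]
  · rw [quadForm_const_idMap, Real.coe_toNNReal _ hlm.le]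
    gcongr

lemma measurable_coord_of_measurable_norm_sub {𝒳 : Type*} [MeasurableSpace 𝒳]
    {b : 𝒳 → EuclideanSpace ℝ (Fin p)} (hB : 0 < B)
    (h : ∀ β : EuclideanSpace ℝ (Fin p), ‖β‖ ≤ B → Measurable fun x => ‖b x - β‖) (j : Fin p) :
    Measurable fun x => b x j := by
  have h0 := h 0 (by simpa using hB.le)
  have hj := h (EuclideanSpace.single j B) (by simp [abs_of_pos hB])
  have : (fun x => b x j) = fun x =>
      (‖b x - 0‖ ^ 2 - ‖b x - EuclideanSpace.single j B‖ ^ 2 + B ^ 2) / (2 * B) := by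
    funext x
    rw [@norm_sub_sq_real _ _ _ (b x) (EuclideanSpace.single j B),
      EuclideanSpace.inner_single_right]
    simp
    field_simp
    ring
  rw [this]
  fun_prop

lemma gaussianMechanism_beta (v : Fin p → ℝ≥0)
    (T : (Fin p → ℝ) →L[ℝ] EuclideanSpace ℝ (Fin p)) (β : EuclideanSpace ℝ (Fin p)) {σ : ℝ}
    (hσ : 0 ≤ σ) : (gaussianMechanism v T β σ hσ).beta = β := rfl

lemma measurable_norm_sub_of_mem_estimators {b : Sample O n N → EuclideanSpace ℝ (Fin p)}
    (hb : b ∈ estimators O n N χ C CX lm lp R B κ) {P : Mechanism p}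
    (hP : P ∈ classOSS p χ C CX lm lp R B κ) : Measurable fun x => ‖b x - P.beta‖ :=
  hb P hP

/-- Assouad's lemma for the minimax risk over the Gaussian class. Estimators are measurable because
their distances to all points of a ball are. -/
theorem assouad_minimaxRiskGauss (hR : 0 < R) (hB : 0 < B) (hlm : 0 < lm) (hlmp : lm < lp)
    (hχ : 0 < χ) (hχ1 : χ ≤ 1) (hC : 1 ≤ C) (hCX : √(8 * lp / 3) ≤ CX)
    (hκ : (105 : ℝ) ^ (1 / 4 : ℝ) ≤ κ) (P : (Fin p → Bool) → Mechanism p)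
    (hP : ∀ τ, P τ ∈ classOSSGauss p χ C CX lm lp R B κ)
    (S : Finset (Fin p)) (d : Fin p → ℝ)
    (hβ : ∀ τ, ∀ a ∈ S, (P τ).beta a = boolSign (τ a) * d a)
    (haff : ∀ τ, ∀ j ∈ S,
      AffinityDefectLE (dataLaw O n N (P τ)) (dataLaw O n N (P (flipAt j τ))) (1 / 2)) :
    ENNReal.ofReal (1 / 32 * ∑ a ∈ S, d a ^ 2)
      ≤ minimaxRiskGauss O n N χ C CX lm lp R B κ := by
  refine le_iInf₂ fun b hb => ?_
  have hm : ∀ β : EuclideanSpace ℝ (Fin p), ‖β‖ ≤ B → Measurable fun x => ‖b x - β‖ := by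
    intro β hβB
    have h := measurable_norm_sub_of_mem_estimators hb
      (isotropic_mem_classOSSGauss hR hlm hlmp hχ hχ1 hC hCX hκ hβB).1
    rwa [gaussianMechanism_beta] at h
  have hc := measurable_coord_of_measurable_norm_sub hB hm
  have hM : ∀ τ, ∫⁻ x, ENNReal.ofReal (‖b x - (P τ).beta‖ ^ 2) ∂(dataLaw O n N (P τ))
      ≤ ⨆ P ∈ classOSSGauss p χ C CX lm lp R B κ,
        ∫⁻ x, ENNReal.ofReal (‖b x - P.beta‖ ^ 2) ∂(dataLaw O n N P) :=
    fun τ => le_iSup₂ (f := fun P (_ : P ∈ classOSSGauss p χ C CX lm lp R B κ) =>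
      ∫⁻ x, ENNReal.ofReal (‖b x - P.beta‖ ^ 2) ∂(dataLaw O n N P)) (P τ) (hP τ)
  exact assouad (fun τ => dataLaw O n N (P τ)) (fun τ => (P τ).beta) hc S d hβ haff hM

end Assouad

/-! ### The error of estimating the coefficients with known isotropic covariance -/

section Isotropic

variable {p : ℕ}

lemma inner_idMap (g : Fin p → ℝ) (β : EuclideanSpace ℝ (Fin p)) :
    inner ℝ (idMap p g) β = ∑ a, g a * β a := by
  rw [PiLp.inner_apply]
  refine Finset.sum_congr rfl fun a _ => ?_
  simp [mul_comm]

/-- Flipping the sign of a coefficient whose covariate is observed. The unobserved covariates act as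
additional noise of variance `l ∑ β a ^ 2`: the shift of the response is spread over them and the
noise proportionally to their contributions to its conditional variance. -/
lemma affinityDefectLE_observedLaw_isotropic {l : ℝ≥0} (hl : l ≠ 0) {R : ℝ} (hR : 0 < R)
    {O : Finset (Fin p)} {i : Fin p} (hi : i ∈ O) {β β' : EuclideanSpace ℝ (Fin p)}
    (hβi : β' i = -β i) (hβ : ∀ a, a ≠ i → β' a = β a) :
    AffinityDefectLE ((gaussianMechanism (fun _ => l) (idMap p) β R hR.le).observedLaw O)
      ((gaussianMechanism (fun _ => l) (idMap p) β' R hR.le).observedLaw O)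
      (β i ^ 2 * l / (2 * (R ^ 2 + l * ∑ a ∈ Oᶜ, β a ^ 2))) := by
  set W : ℝ := R ^ 2 + l * ∑ a ∈ Oᶜ, β a ^ 2 with hW
  have hl0 : (0 : ℝ) < l := by positivity
  have hs0 : 0 ≤ ∑ a ∈ Oᶜ, β a ^ 2 := Finset.sum_nonneg fun a _ => sq_nonneg _
  have hW0 : 0 < W := by positivity
  have hR2 : (0 : ℝ) < R ^ 2 := by positivity
  set d : Fin p → ℝ := fun a => if a ∈ O then 0 else -2 * β i * (l * β a / W) with hd
  set d₀ : ℝ := -2 * β i * (R ^ 2 / W) with hd₀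
  have hsum : ∀ c : Fin p → ℝ, ∑ a, (if a ∈ O then 0 else c a) = ∑ a ∈ Oᶜ, c a := by
    intro c
    rw [← Finset.sum_filter_not_add_sum_filter Finset.univ (fun a => a ∈ O)]
    rw [Finset.sum_congr (s₁ := Finset.univ.filter fun a => a ∈ O) rfl
      (g := fun _ => (0 : ℝ)) (fun a ha => by simp [(Finset.mem_filter.1 ha).2]),
      Finset.sum_const_zero, add_zero]
    refine Finset.sum_congr (by ext; simp) fun a ha => ?_
    rw [if_neg (by simpa using ha)]
  have hF : Measurable fun q : (Fin p → ℝ) × ℝ =>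
      ((fun a : O => idMap p q.1 a), inner ℝ (idMap p q.1) β + q.2) := by fun_prop
  have h := affinityDefectLE_gaussianBase_shear (v := fun _ => l) (w := (R ^ 2).toNNReal) (j := i)
    (d := d) (fun _ => hl) (by simpa using hR.ne') (by simp [hd, hi]) d₀ hF
  rw [gaussianMechanism_observedLaw, gaussianMechanism_observedLaw]
  have e1 : (fun q : (Fin p → ℝ) × ℝ =>
      ((fun a : O => idMap p q.1 a), inner ℝ (idMap p q.1) β' + q.2))
      = fun q => ((fun a : O => idMap p (q.1 + q.1 i • d) a),
        inner ℝ (idMap p (q.1 + q.1 i • d)) β + (q.2 + q.1 i * d₀)) := by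
    funext q
    refine Prod.ext (funext fun a => ?_) ?_
    · simp [hd, a.2]
    · simp only [inner_idMap, Pi.add_apply, Pi.smul_apply, smul_eq_mul, add_mul,
        Finset.sum_add_distrib]
      have h1 : ∑ a, q.1 a * β' a = ∑ a, q.1 a * β a + q.1 i * (-2 * β i) := by
        rw [← Finset.add_sum_erase _ _ (Finset.mem_univ i),
          ← Finset.add_sum_erase Finset.univ (fun a => q.1 a * β a) (Finset.mem_univ i), hβi,
          Finset.sum_congr rfl (g := fun a => q.1 a * β a)
            (fun a ha => by rw [hβ a (Finset.ne_of_mem_erase ha)])]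
        ring
      have h2 : ∑ a, q.1 i * d a * β a
          = q.1 i * (-2 * β i) * (l * (∑ a ∈ Oᶜ, β a ^ 2) / W) := by
        rw [mul_div_assoc, Finset.sum_div, Finset.mul_sum, Finset.mul_sum, ← hsum]
        refine Finset.sum_congr rfl fun a _ => ?_
        simp only [hd]
        split_ifs
        · simp
        · ring
      have h3 : (l * (∑ a ∈ Oᶜ, β a ^ 2) / W) + R ^ 2 / W = 1 := by
        rw [← add_div, add_comm, ← hW, div_self hW0.ne']
      rw [h1, h2, hd₀]
      linear_combination (-(q.1 i * (-2 * β i))) * h3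
  rw [e1]
  refine h.mono (le_of_eq ?_)
  have h4 : ∑ a, d a ^ 2 / (8 * (l : ℝ)) = β i ^ 2 * (l * ∑ a ∈ Oᶜ, β a ^ 2) / (2 * W ^ 2) := by
    rw [Finset.mul_sum, Finset.mul_sum, Finset.sum_div, ← hsum]
    refine Finset.sum_congr rfl fun a _ => ?_
    simp only [hd]
    split_ifs
    · simp
    · field_simp
      ring
  rw [h4, Real.coe_toNNReal _ hR2.le, hd₀]
  have h5 : (l : ℝ) * ∑ a ∈ Oᶜ, β a ^ 2 = W - R ^ 2 := by rw [hW]; ring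
  rw [h5]
  field_simp
  ring

/-- Flipping the sign of a coefficient whose covariate is not observed does not change the law. -/
lemma observedLaw_isotropic_eq {l : ℝ≥0} {R : ℝ} (hR : 0 < R)
    {O : Finset (Fin p)} {i : Fin p} (hi : i ∉ O) {β β' : EuclideanSpace ℝ (Fin p)}
    (hβi : β' i = -β i) (hβ : ∀ a, a ≠ i → β' a = β a) :
    (gaussianMechanism (fun _ => l) (idMap p) β' R hR.le).observedLaw O
      = (gaussianMechanism (fun _ => l) (idMap p) β R hR.le).observedLaw O := by
  have hF : Measurable fun q : (Fin p → ℝ) × ℝ =>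
      ((fun a : O => idMap p q.1 a), inner ℝ (idMap p q.1) β + q.2) := by fun_prop
  rw [gaussianMechanism_observedLaw, gaussianMechanism_observedLaw,
    ← gaussianBase_map_reflect i hF]
  congr 1
  funext q
  refine Prod.ext (funext fun a => ?_) ?_
  · have : (a : Fin p) ≠ i := fun h => hi (h ▸ a.2)
    simp [this]
  · simp only [inner_idMap]
    congr 1
    refine Finset.sum_congr rfl fun a _ => ?_
    by_cases ha : a = i
    · subst ha; simp [hβi]
    · simp [ha, hβ a ha]

end Isotropic

section Blocks

variable {p L : ℕ} {ξ : Fin p → Fin L} {rep : Fin L → Fin p}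

lemma sum_representatives (hrep : ∀ g, ξ (rep g) = g) (h : Fin L → ℝ) :
    ∑ a, (if a = rep (ξ a) then h (ξ a) else 0) = ∑ g, h g := by
  rw [← Finset.sum_fiberwise Finset.univ ξ]
  refine Finset.sum_congr rfl fun g _ => ?_
  rw [Finset.sum_congr rfl (g := fun a => if a = rep g then h g else 0)
    (fun a ha => by rw [(Finset.mem_filter.1 ha).2])]
  rw [Finset.sum_ite_eq']
  simp [hrep]

/-- Dropping one representative of each block keeps half of a sum of nonnegative terms which are
constant on blocks, as the blocks have at least two elements. -/
lemma half_sum_le_sum_nonrepresentatives (hrep : ∀ g, ξ (rep g) = g)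
    (hcard : ∀ g, 2 ≤ (modality ξ g).card) {A : Fin L → ℝ} (hA : ∀ g, 0 ≤ A g) :
    1 / 2 * ∑ a, A (ξ a) ≤ ∑ a ∈ Finset.univ.filter (fun a => a ≠ rep (ξ a)), A (ξ a) := by
  have h1 : ∑ a, A (ξ a) = ∑ g, ((modality ξ g).card : ℝ) * A g := by
    rw [← Finset.sum_fiberwise Finset.univ ξ]
    refine Finset.sum_congr rfl fun g _ => ?_
    rw [Finset.sum_congr rfl (g := fun _ => A g)
      (fun a ha => by rw [(Finset.mem_filter.1 ha).2]), Finset.sum_const, nsmul_eq_mul]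
    rfl
  have h2 : 2 * ∑ g, A g ≤ ∑ a, A (ξ a) := by
    rw [h1, Finset.mul_sum]
    exact Finset.sum_le_sum fun g _ =>
      mul_le_mul_of_nonneg_right (by exact_mod_cast hcard g) (hA g)
  have h3 := Finset.sum_filter_add_sum_filter_not Finset.univ (fun a => a ≠ rep (ξ a))
    (fun a => A (ξ a))
  have h4 : ∑ a ∈ Finset.univ.filter (fun a => ¬ a ≠ rep (ξ a)), A (ξ a) = ∑ g, A g := by
    rw [← sum_representatives hrep A, Finset.sum_filter]
    simp
  linarith

end Blocks

section Estimation

variable {p K L N : ℕ} {O : Fin K → Finset (Fin p)} {n : Fin K → ℕ} {ξ : Fin p → Fin L}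
  {χ C CX lm lp R B κ : ℝ}

lemma effSize_eq_of_block {z : EuclideanSpace ℝ (Fin p)} (hO : IsBlockPartition O ξ) {a b : Fin p}
    (h : ξ a = ξ b) : effSize O n R z a = effSize O n R z b := by
  refine Finset.sum_congr rfl fun k _ => ?_
  obtain ⟨T, hT⟩ := hO.union k
  simp only [hT, h]

/-- The contribution of the effective sample sizes. In each block one coefficient is fixed, so that
its square is half the squared norm of the block of `z`; the others have random signs and size
`δ a`, where `δ a ^ 2` is of the order of the inverse information `R ^ 2 / α a`. The noise
level caused by the unobserved covariates is then that of `z`, up to constants, and does not depend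
on the signs. -/
theorem effSize_bound (hO : IsBlockPartition O ξ) (hR : 0 < R) (hB : 0 < B) (hlm : 0 < lm)
    (hlmp : lm < lp) (hχ : 0 < χ) (hχ1 : χ ≤ 1) (hC : 1 ≤ C) (hCX : √(8 * lp / 3) ≤ CX)
    (hκ : (105 : ℝ) ^ (1 / 4 : ℝ) ≤ κ) {z : EuclideanSpace ℝ (Fin p)} (hz : ‖z‖ ≤ B)
    (hα : ∀ i : Fin p, 1 / 2 * max (1 / lm) lm * max (R ^ 2 / B ^ 2) (B ^ 2 / R ^ 2) * p
      ≤ effSize O n R z i)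
    (hcard : ∀ g, 2 ≤ (modality ξ g).card) :
    ENNReal.ofReal (1 / 256 * (R ^ 2 / max 1 lm * ∑ i : Fin p, 1 / effSize O n R z i))
      ≤ minimaxRiskGauss O n N χ C CX lm lp R B κ := by
  classical
  choose rep hrep using hO.surjective
  set m : ℝ := max 1 lm with hm
  have hm1 : 1 ≤ m := le_max_left _ _
  have hml : lm ≤ m := le_max_right _ _
  have hm0 : 0 < m := by linarith
  set α : Fin p → ℝ := effSize O n R z with hαdef
  have hR2 : 0 < R ^ 2 := by positivity
  have hB2 : 0 < B ^ 2 := by positivity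
  have hp0 : ∀ _ : Fin p, (0 : ℝ) < p := fun a => by
    exact_mod_cast Nat.lt_of_le_of_lt (Nat.zero_le _) a.2
  have hmα : ∀ a, R ^ 2 * p ≤ 2 * B ^ 2 * (m * α a) := by
    intro a
    have h1 := hα a
    have h2 : 1 ≤ m * max (1 / lm) lm := by
      rcases le_total lm 1 with h | h
      · have : 1 ≤ max (1 / lm) lm := le_max_of_le_left (by rw [le_div_iff₀ hlm]; linarith)
        nlinarith
      · have : 1 ≤ max (1 / lm) lm := le_max_of_le_right h
        nlinarith
    have h3 : R ^ 2 / B ^ 2 ≤ max (R ^ 2 / B ^ 2) (B ^ 2 / R ^ 2) := le_max_left _ _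
    have h4 : R ^ 2 / B ^ 2 * p ≤ 2 * (m * α a) := by
      calc R ^ 2 / B ^ 2 * p ≤ 1 * (max (R ^ 2 / B ^ 2) (B ^ 2 / R ^ 2) * p) := by
            rw [one_mul]; gcongr
        _ ≤ (m * max (1 / lm) lm) * (max (R ^ 2 / B ^ 2) (B ^ 2 / R ^ 2) * p) := by
            gcongr
        _ = 2 * (m * (1 / 2 * max (1 / lm) lm * max (R ^ 2 / B ^ 2) (B ^ 2 / R ^ 2) * p)) := by
            ring
        _ ≤ _ := by gcongr
    rw [div_mul_eq_mul_div, div_le_iff₀ hB2] at h4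
    linarith
  have hα0 : ∀ a, 0 < α a := by
    intro a
    have h1 : 0 < 2 * B ^ 2 * (m * α a) :=
      lt_of_lt_of_le (mul_pos hR2 (hp0 a)) (hmα a)
    exact pos_of_mul_pos_right (pos_of_mul_pos_right h1 (by positivity)) hm0.le
  -- With the factor `4`, the perturbations use up at most half of the squared radius `B ^ 2`, and
  -- a flip costs at most `1 / 4`.
  set δ : Fin p → ℝ := fun a => √(R ^ 2 / (4 * m * α a)) with hδ
  have hδ2 : ∀ a, δ a ^ 2 = R ^ 2 / (4 * m * α a) := fun a =>
    Real.sq_sqrt (by have := hα0 a; positivity)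
  set s : Fin L → ℝ := fun g => ∑ b ∈ Finset.univ.filter (fun b => ξ b = g), z b ^ 2 with hs
  have hs0 : ∀ g, 0 ≤ s g := fun g => Finset.sum_nonneg fun _ _ => sq_nonneg _
  have hsum_s : ∀ u : Fin L → ℝ, ∑ g, u g * s g = ∑ a, u (ξ a) * z a ^ 2 := by
    intro u
    rw [← Finset.sum_fiberwise Finset.univ ξ]
    refine Finset.sum_congr rfl fun g _ => ?_
    rw [hs, Finset.mul_sum]
    exact Finset.sum_congr rfl fun a ha => by rw [(Finset.mem_filter.1 ha).2]
  set β : (Fin p → Bool) → EuclideanSpace ℝ (Fin p) := fun τ =>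
    WithLp.toLp 2 fun a => if a = rep (ξ a) then √(s (ξ a) / 2) else boolSign (τ a) * δ a with hβ
  have hβa : ∀ τ a, β τ a = if a = rep (ξ a) then √(s (ξ a) / 2) else boolSign (τ a) * δ a :=
    fun _ _ => rfl
  have hβ2 : ∀ τ a, β τ a ^ 2 = if a = rep (ξ a) then s (ξ a) / 2 else δ a ^ 2 := by
    intro τ a
    rw [hβa]
    split_ifs
    · exact Real.sq_sqrt (by have := hs0 (ξ a); positivity)
    · rw [mul_pow, boolSign_sq, one_mul]
  have hnorm : ∀ τ, ‖β τ‖ ≤ B := by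
    intro τ
    refine abs_le_of_sq_le_sq' ?_ hB.le |>.2
    rw [EuclideanSpace.real_norm_sq_eq]
    have hδB : ∑ a, δ a ^ 2 ≤ B ^ 2 / 2 := by
      calc ∑ a, δ a ^ 2 ≤ ∑ _a : Fin p, B ^ 2 / (2 * p) := by
            refine Finset.sum_le_sum fun a _ => ?_
            have := hα0 a
            have := hp0 a
            rw [hδ2, div_le_div_iff₀ (by positivity) (by positivity)]
            nlinarith [hmα a]
        _ ≤ B ^ 2 / 2 := by
            rw [Finset.sum_const, nsmul_eq_mul, Finset.card_univ, Fintype.card_fin]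
            rcases Nat.eq_zero_or_pos p with h | h
            · simp [h]; positivity
            · have : (0 : ℝ) < p := by exact_mod_cast h
              exact le_of_eq (by field_simp)
    have hsB : ∑ g, s g / 2 ≤ B ^ 2 / 2 := by
      have := hsum_s fun _ => 1
      simp only [one_mul] at this
      rw [← Finset.sum_div, this, ← EuclideanSpace.real_norm_sq_eq]
      have := norm_nonneg z
      gcongr
    calc ∑ a, β τ a ^ 2
        ≤ ∑ a, ((if a = rep (ξ a) then s (ξ a) / 2 else 0) + δ a ^ 2) := by
          refine Finset.sum_le_sum fun a _ => ?_
          rw [hβ2]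
          split_ifs
          · linarith [sq_nonneg (δ a)]
          · linarith
      _ = ∑ g, s g / 2 + ∑ a, δ a ^ 2 := by
          rw [Finset.sum_add_distrib, sum_representatives hrep fun g => s g / 2]
      _ ≤ B ^ 2 := by linarith
  -- The norm of `β τ` on the unobserved blocks is comparable to that of `z`, for all signs.
  have hmiss : ∀ τ k, ∑ a ∈ (O k)ᶜ, z a ^ 2 ≤ 2 * ∑ a ∈ (O k)ᶜ, β τ a ^ 2 := by
    intro τ k
    obtain ⟨T, hT⟩ := hO.union k
    have hind : ∀ c : Fin p → ℝ,
        ∑ a ∈ (O k)ᶜ, c a = ∑ a, (if ξ a ∈ T then 0 else 1) * c a := by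
      intro c
      rw [show (O k)ᶜ = Finset.univ.filter (fun a => ¬ ξ a ∈ T) by ext a; simp [hT],
        Finset.sum_filter]
      refine Finset.sum_congr rfl fun a _ => ?_
      by_cases hx : ξ a ∈ T <;> simp [hx]
    rw [hind, hind, ← hsum_s fun g => if g ∈ T then 0 else 1,
      ← sum_representatives hrep, Finset.mul_sum]
    refine Finset.sum_le_sum fun a _ => ?_
    rw [hβ2]
    split_ifs <;> simp <;> try linarith
    positivity
  set S := Finset.univ.filter (fun a => a ≠ rep (ξ a)) with hS
  have main := assouad_minimaxRiskGauss (O := O) (n := n) (N := N) hR hB hlm hlmp hχ hχ1 hC hCX hκ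
    (fun τ => gaussianMechanism (fun _ => lm.toNNReal) (idMap p) (β τ) R hR.le)
    (fun τ => isotropic_mem_classOSSGauss hR hlm hlmp hχ hχ1 hC hCX hκ (hnorm τ)) S δ
    (fun τ a ha => by
      rw [gaussianMechanism_beta, hβa, if_neg (Finset.mem_filter.1 ha).2])
    (fun τ i hi => by
      have hi' := (Finset.mem_filter.1 hi).2
      have hflip_i : β (flipAt i τ) i = -β τ i := by
        rw [hβa, hβa, if_neg hi', if_neg hi', flipAt_self, boolSign_not, neg_mul]
      have hflip : ∀ a, a ≠ i → β (flipAt i τ) a = β τ a := by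
        intro a ha
        rw [hβa, hβa, flipAt_of_ne ha]
      have hl0 : lm.toNNReal ≠ 0 := by simpa using hlm
      refine (affinityDefectLE_dataLaw (e := fun k => if i ∈ O k then
        δ i ^ 2 * lm / (2 * (R ^ 2 + lm * ∑ a ∈ (O k)ᶜ, β τ a ^ 2)) else 0) (e₀ := 0)
        (fun k => ?_) ?_ (fun k => ?_) le_rfl).mono ?_
      · split_ifs with hk
        · have := affinityDefectLE_observedLaw_isotropic hl0 hR hk hflip_i hflip
          rwa [hβ2, if_neg hi', Real.coe_toNNReal _ hlm.le] at this
        · rw [observedLaw_isotropic_eq hR hk hflip_i hflip]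
          exact AffinityDefectLE.refl _
      · rw [gaussianMechanism_covariateLaw, gaussianMechanism_covariateLaw,
          ← gaussianMechanism_covariateLaw _ _ (β τ) hR.le]
        exact AffinityDefectLE.refl _
      · have : 0 ≤ ∑ a ∈ (O k)ᶜ, β τ a ^ 2 := Finset.sum_nonneg fun _ _ => sq_nonneg _
        dsimp only
        split_ifs
        · positivity
        · exact le_rfl
      · calc ∑ k, (n k : ℝ) * (if i ∈ O k then
              δ i ^ 2 * lm / (2 * (R ^ 2 + lm * ∑ a ∈ (O k)ᶜ, β τ a ^ 2)) else 0) + N * 0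
            ≤ ∑ k, δ i ^ 2 * m / R ^ 2 * (if i ∈ O k then n k * weight O R z k else 0) := by
              rw [mul_zero, add_zero]
              refine Finset.sum_le_sum fun k _ => ?_
              split_ifs
              · rw [weight]
                have h0 : 0 ≤ ∑ a ∈ (O k)ᶜ, β τ a ^ 2 := Finset.sum_nonneg fun _ _ => sq_nonneg _
                have h1 : 0 ≤ ∑ a ∈ (O k)ᶜ, z a ^ 2 := Finset.sum_nonneg fun _ _ => sq_nonneg _
                have h2 := hmiss τ k
                generalize ∑ a ∈ (O k)ᶜ, β τ a ^ 2 = x at *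
                generalize ∑ a ∈ (O k)ᶜ, z a ^ 2 = y at *
                have h3 : lm / (2 * (R ^ 2 + lm * x)) ≤ m / (R ^ 2 + y) := by
                  rw [div_le_div_iff₀ (by positivity) (by positivity)]
                  nlinarith [mul_nonneg (sub_nonneg.2 hm1) (mul_nonneg hlm.le h0),
                    mul_nonneg (sub_nonneg.2 hml) hR2.le, mul_nonneg hm0.le hR2.le,
                    mul_nonneg hlm.le (sub_nonneg.2 h2)]
                calc (n k : ℝ) * (δ i ^ 2 * lm / (2 * (R ^ 2 + lm * x)))
                    = n k * δ i ^ 2 * (lm / (2 * (R ^ 2 + lm * x))) := by ring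
                  _ ≤ n k * δ i ^ 2 * (m / (R ^ 2 + y)) := by gcongr
                  _ = _ := by field_simp
              · simp
          _ = δ i ^ 2 * m / R ^ 2 * α i := by rw [← Finset.mul_sum]; rfl
          _ ≤ 1 / 2 := by
              have := hα0 i
              rw [hδ2]
              have : R ^ 2 / (4 * m * α i) * m / R ^ 2 * α i = 1 / 4 := by field_simp
              rw [this]; norm_num)
  refine le_trans (ENNReal.ofReal_le_ofReal ?_) main
  have hAeq : ∀ a, α a = α (rep (ξ a)) := fun a => effSize_eq_of_block hO (hrep _).symm
  have hhalf := half_sum_le_sum_nonrepresentatives hrep hcard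
    (A := fun g => R ^ 2 / (4 * m * α (rep g))) fun g => by have := hα0 (rep g); positivity
  simp_rw [← hAeq, ← hδ2] at hhalf
  have htot : ∑ a, δ a ^ 2 = 1 / 4 * (R ^ 2 / m * ∑ i : Fin p, 1 / α i) := by
    rw [Finset.mul_sum, Finset.mul_sum]
    refine Finset.sum_congr rfl fun a _ => ?_
    have := hα0 a
    rw [hδ2]
    field_simp
  rw [htot] at hhalf
  linarith

end Estimation

/-! ### The error caused by unknown cross-covariances -/

section Shear

variable {p : ℕ}

/-- The covariates `X a = g a` for `a ≠ i` and `X i = g i + ∑ c b * g b`. -/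
noncomputable def shearMap (i : Fin p) (c : Fin p → ℝ) :
    (Fin p → ℝ) →L[ℝ] EuclideanSpace ℝ (Fin p) :=
  idMap p + (∑ b, c b • (ContinuousLinearMap.proj b : (Fin p → ℝ) →L[ℝ] ℝ)).smulRight
    (EuclideanSpace.single i 1)

lemma shearMap_apply (i : Fin p) (c g : Fin p → ℝ) (a : Fin p) :
    shearMap i c g a = g a + if a = i then ∑ b, c b * g b else 0 := by
  simp [shearMap]

lemma quadForm_shearMap (v : Fin p → ℝ≥0) (i : Fin p) (c : Fin p → ℝ)
    (θ : EuclideanSpace ℝ (Fin p)) :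
    quadForm v (shearMap i c) θ = ∑ a, v a * (θ a + c a * θ i) ^ 2 := by
  refine Finset.sum_congr rfl fun a _ => ?_
  rw [PiLp.inner_apply]
  congr 2
  calc ∑ b, inner ℝ (shearMap i c (Pi.single a 1) b) (θ b)
      = ∑ b, ((if b = a then θ b else 0) + if b = i then c a * θ b else 0) := by
        refine Finset.sum_congr rfl fun b _ => ?_
        rw [shearMap_apply]
        simp only [Pi.single_apply, mul_ite, mul_one, mul_zero, Finset.sum_ite_eq',
          Finset.mem_univ, if_true]
        split_ifs <;> simp <;> ring
    _ = _ := by rw [Finset.sum_add_distrib]; simp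

/-- With the coefficients `-c a * β i` for `a ≠ i`, the response depends on the covariates only
through the innovation `g i`. -/
lemma inner_shearMap {i : Fin p} {c : Fin p → ℝ} (hc : c i = 0) {β : EuclideanSpace ℝ (Fin p)}
    (hβ : ∀ a, a ≠ i → β a = -c a * β i) (g : Fin p → ℝ) :
    inner ℝ (shearMap i c g) β = g i * β i := by
  rw [PiLp.inner_apply]
  calc ∑ a, inner ℝ (shearMap i c g a) (β a)
      = ∑ a, (g a * β a + if a = i then (∑ b, c b * g b) * β i else 0) := by
        refine Finset.sum_congr rfl fun a _ => ?_
        rw [shearMap_apply]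
        by_cases h : a = i
        · subst h; simp; ring
        · simp [h]; ring
    _ = ∑ a, (g a * β a + c a * g a * β i) := by
        rw [Finset.sum_add_distrib, Finset.sum_add_distrib, ← Finset.sum_mul]; simp
    _ = ∑ a, if a = i then g i * β i else 0 := by
        refine Finset.sum_congr rfl fun a _ => ?_
        by_cases h : a = i
        · subst h; simp [hc]
        · rw [hβ a h, if_neg h]; ring
    _ = _ := by simp

variable {v : Fin p → ℝ≥0} {i j : Fin p} {c c' : Fin p → ℝ} {R : ℝ}
  {β β' : EuclideanSpace ℝ (Fin p)}

lemma sum_mul_flip (hcj : c' j = -c j) (hcc : ∀ a, a ≠ j → c' a = c a) (g : Fin p → ℝ) :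
    ∑ b, c' b * g b = ∑ b, c b * g b - 2 * c j * g j := by
  rw [← Finset.add_sum_erase _ _ (Finset.mem_univ j),
    ← Finset.add_sum_erase Finset.univ (fun b => c b * g b) (Finset.mem_univ j), hcj,
    Finset.sum_congr rfl (g := fun b => c b * g b)
      (fun b hb => by rw [hcc b (Finset.ne_of_mem_erase hb)])]
  ring

lemma sum_mul_add_single (hc : c i = 0) (g : Fin p → ℝ) (t : ℝ) :
    ∑ b, c b * (g + t • Pi.single (M := fun _ => ℝ) i 1) b = ∑ b, c b * g b := by
  refine Finset.sum_congr rfl fun b _ => ?_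
  by_cases h : b = i
  · subst h; simp [hc]
  · simp [h]

lemma shearMap_flip (hji : j ≠ i) (hc : c i = 0) (hcj : c' j = -c j)
    (hcc : ∀ a, a ≠ j → c' a = c a) (g : Fin p → ℝ) :
    shearMap i c' g = shearMap i c (g + g j • ((-2 * c j) • Pi.single (M := fun _ => ℝ) i 1)) := by
  ext a
  rw [shearMap_apply, shearMap_apply, smul_smul, sum_mul_add_single hc,
    sum_mul_flip hcj hcc]
  by_cases h : a = i
  · subst h; simp; ring
  · simp [h]

/-- Flipping the sign of the cross-covariance of the covariates `i` and `j`, for the labelled data: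
the change of `X i` is compensated by its innovation `g i`, whose contribution to the response is
in turn compensated by the noise. -/
lemma affinityDefectLE_observedLaw_shear (hv : ∀ a, v a ≠ 0) (hR : 0 < R) (hji : j ≠ i)
    (hc : c i = 0) (hcj : c' j = -c j) (hcc : ∀ a, a ≠ j → c' a = c a)
    (hβ : ∀ a, a ≠ i → β a = -c a * β i) (hβ' : ∀ a, a ≠ i → β' a = -c' a * β' i)
    (hββ : β' i = β i) (O : Finset (Fin p)) :
    AffinityDefectLE ((gaussianMechanism v (shearMap i c) β R hR.le).observedLaw O)
      ((gaussianMechanism v (shearMap i c') β' R hR.le).observedLaw O)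
      (v j * c j ^ 2 * (1 / v i + β i ^ 2 / R ^ 2) / 2) := by
  have hF : Measurable fun q : (Fin p → ℝ) × ℝ =>
      ((fun a : O => shearMap i c q.1 a), inner ℝ (shearMap i c q.1) β + q.2) := by fun_prop
  have h := affinityDefectLE_gaussianBase_shear (v := v) (w := (R ^ 2).toNNReal) (j := j)
    (d := (-2 * c j) • Pi.single i 1) hv (by simpa using hR.ne') (by simp [hji])
    (2 * c j * β i) hF
  rw [gaussianMechanism_observedLaw, gaussianMechanism_observedLaw]
  have hc' : c' i = 0 := by rw [hcc i hji.symm, hc]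
  have e1 : (fun q : (Fin p → ℝ) × ℝ =>
      ((fun a : O => shearMap i c' q.1 a), inner ℝ (shearMap i c' q.1) β' + q.2))
      = fun q => ((fun a : O =>
          shearMap i c (q.1 + q.1 j • ((-2 * c j) • Pi.single (M := fun _ => ℝ) i 1)) a),
        inner ℝ (shearMap i c (q.1 + q.1 j • ((-2 * c j) • Pi.single (M := fun _ => ℝ) i 1))) β
          + (q.2 + q.1 j * (2 * c j * β i))) := by
    funext q
    refine Prod.ext (funext fun a => ?_) ?_
    · simp only [shearMap_flip hji hc hcj hcc]
    · simp only [inner_shearMap hc hβ, inner_shearMap hc' hβ', hββ]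
      simp
      ring
  rw [e1]
  refine h.mono (le_of_eq ?_)
  rw [Finset.sum_eq_single i (fun a _ ha => by simp [ha]) (by simp),
    Real.coe_toNNReal _ (sq_nonneg R)]
  have : (v i : ℝ) ≠ 0 := by exact_mod_cast hv i
  simp
  field_simp
  ring

/-- Flipping the sign of the cross-covariance of the covariates `i` and `j`, for the unlabelled
data. -/
lemma affinityDefectLE_covariateLaw_shear (hv : ∀ a, v a ≠ 0) (hR : 0 < R) (hji : j ≠ i)
    (hc : c i = 0) (hcj : c' j = -c j) (hcc : ∀ a, a ≠ j → c' a = c a) :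
    AffinityDefectLE (gaussianMechanism v (shearMap i c) β R hR.le).covariateLaw
      (gaussianMechanism v (shearMap i c') β' R hR.le).covariateLaw
      (v j * c j ^ 2 / (2 * v i)) := by
  have hF : Measurable fun q : (Fin p → ℝ) × ℝ => shearMap i c q.1 := by fun_prop
  have h := affinityDefectLE_gaussianBase_shear (v := v) (w := (R ^ 2).toNNReal) (j := j)
    (d := (-2 * c j) • Pi.single i 1) hv (by simpa using hR.ne') (by simp [hji]) 0 hF
  rw [gaussianMechanism_covariateLaw, gaussianMechanism_covariateLaw]
  simp_rw [shearMap_flip hji hc hcj hcc]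
  refine h.mono (le_of_eq ?_)
  rw [Finset.sum_eq_single i (fun a _ ha => by simp [ha]) (by simp)]
  have : (v i : ℝ) ≠ 0 := by exact_mod_cast hv i
  simp
  field_simp
  ring

/-- The sign of the cross-covariance of the covariates `i` and `j` has no influence on the labelled
data in which only one of them is observed: if `X i` is missing, the data are functions of the
independent variables `g` and the noise alone; if `X j` is missing, `g j` may be reflected. -/
lemma observedLaw_shear_eq (hR : 0 < R) (hji : j ≠ i)
    (hc : c i = 0) (hcj : c' j = -c j) (hcc : ∀ a, a ≠ j → c' a = c a)
    (hβ : ∀ a, a ≠ i → β a = -c a * β i) (hβ' : ∀ a, a ≠ i → β' a = -c' a * β' i)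
    (hββ : β' i = β i) {O : Finset (Fin p)} (hO : ¬ (i ∈ O ∧ j ∈ O)) :
    (gaussianMechanism v (shearMap i c') β' R hR.le).observedLaw O
      = (gaussianMechanism v (shearMap i c) β R hR.le).observedLaw O := by
  have hc' : c' i = 0 := by rw [hcc i hji.symm, hc]
  have hF : Measurable fun q : (Fin p → ℝ) × ℝ =>
      ((fun a : O => shearMap i c q.1 a), inner ℝ (shearMap i c q.1) β + q.2) := by fun_prop
  rw [gaussianMechanism_observedLaw, gaussianMechanism_observedLaw]
  by_cases hi : i ∈ O
  · have hj : j ∉ O := fun hj => hO ⟨hi, hj⟩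
    rw [← gaussianBase_map_reflect j hF]
    congr 1
    funext q
    refine Prod.ext (funext fun a => ?_) ?_
    · have haj : (a : Fin p) ≠ j := fun h => hj (h ▸ a.2)
      simp only [shearMap_apply, Function.update_of_ne haj]
      congr 2
      rw [sum_mul_flip hcj hcc,
        ← Finset.add_sum_erase Finset.univ (fun b => c b * q.1 b) (Finset.mem_univ j),
        ← Finset.add_sum_erase Finset.univ
          (fun b => c b * Function.update q.1 j (-q.1 j) b) (Finset.mem_univ j),
        Finset.sum_congr rfl (f := fun b => c b * Function.update q.1 j (-q.1 j) b)
          (g := fun b => c b * q.1 b) (fun b hb => by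
            rw [Function.update_of_ne (Finset.ne_of_mem_erase hb)]), Function.update_self]
      ring
    · simp only [inner_shearMap hc hβ, inner_shearMap hc' hβ', hββ,
        Function.update_of_ne hji.symm]
  · congr 1
    funext q
    refine Prod.ext (funext fun a => ?_) ?_
    · have hai : (a : Fin p) ≠ i := fun h => hi (h ▸ a.2)
      simp [shearMap_apply, hai]
    · simp only [inner_shearMap hc hβ, inner_shearMap hc' hβ', hββ]

end Shear

section Covariance

variable {p : ℕ} {lm lp R B : ℝ}

/-- The variances of the independent variables `g` which give all covariates of `shearMap i c` the
variance `m`. -/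
noncomputable def innovationVar (m : ℝ) (i : Fin p) (c : Fin p → ℝ) (a : Fin p) : ℝ≥0 :=
  (if a = i then m * (1 - ∑ b, c b ^ 2) else m).toNNReal

lemma quadForm_innovationVar {m : ℝ} (hm : 0 ≤ m) {i : Fin p} {c : Fin p → ℝ} (hc : c i = 0)
    (hc1 : ∑ b, c b ^ 2 ≤ 1) (θ : EuclideanSpace ℝ (Fin p)) :
    quadForm (innovationVar m i c) (shearMap i c) θ
      = m * ‖θ‖ ^ 2 + 2 * m * (θ i * ∑ a, c a * θ a) := by
  rw [quadForm_shearMap]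
  calc ∑ a, (innovationVar m i c a : ℝ) * (θ a + c a * θ i) ^ 2
      = ∑ a, ((m * θ a ^ 2 + 2 * m * θ i * (c a * θ a) + m * θ i ^ 2 * c a ^ 2)
          - if a = i then m * θ i ^ 2 * ∑ b, c b ^ 2 else 0) := by
        refine Finset.sum_congr rfl fun a _ => ?_
        by_cases h : a = i
        · subst h
          rw [innovationVar, if_pos rfl, if_pos rfl,
            Real.coe_toNNReal _ (mul_nonneg hm (by linarith)), hc]
          ring
        · rw [innovationVar, if_neg h, if_neg h, Real.coe_toNNReal _ hm]
          ring
    _ = _ := by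
        rw [Finset.sum_sub_distrib, Finset.sum_add_distrib, Finset.sum_add_distrib,
          ← Finset.mul_sum, ← Finset.mul_sum, ← Finset.mul_sum, EuclideanSpace.real_norm_sq_eq]
        simp
        ring

lemma abs_quadForm_innovationVar_sub_le {m r : ℝ} (hm : 0 ≤ m) (hr : 0 ≤ r) {i : Fin p}
    {c : Fin p → ℝ} (hc : c i = 0) (hc1 : ∑ b, c b ^ 2 ≤ 1)
    (hcr : 4 * m ^ 2 * ∑ b, c b ^ 2 ≤ r ^ 2)
    (θ : EuclideanSpace ℝ (Fin p)) :
    |quadForm (innovationVar m i c) (shearMap i c) θ - m * ‖θ‖ ^ 2| ≤ r * ‖θ‖ ^ 2 := by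
  rw [quadForm_innovationVar hm hc hc1, add_sub_cancel_left]
  refine abs_le_of_sq_le_sq ?_ (by positivity)
  have h1 : (∑ a, c a * θ a) ^ 2 ≤ (∑ b, c b ^ 2) * ‖θ‖ ^ 2 := by
    rw [EuclideanSpace.real_norm_sq_eq]
    exact Finset.sum_mul_sq_le_sq_mul_sq _ _ _
  have h2 : θ i ^ 2 ≤ ‖θ‖ ^ 2 := by
    rw [EuclideanSpace.real_norm_sq_eq]
    exact Finset.single_le_sum (f := fun a => θ a ^ 2) (fun _ _ => sq_nonneg _) (Finset.mem_univ i)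
  have hs : 0 ≤ ∑ b, c b ^ 2 := Finset.sum_nonneg fun _ _ => sq_nonneg _
  calc (2 * m * (θ i * ∑ a, c a * θ a)) ^ 2
      = 4 * m ^ 2 * (θ i ^ 2 * (∑ a, c a * θ a) ^ 2) := by ring
    _ ≤ 4 * m ^ 2 * (‖θ‖ ^ 2 * ((∑ b, c b ^ 2) * ‖θ‖ ^ 2)) := by gcongr
    _ = (4 * m ^ 2 * ∑ b, c b ^ 2) * (‖θ‖ ^ 2) ^ 2 := by ring
    _ ≤ r ^ 2 * (‖θ‖ ^ 2) ^ 2 := by gcongr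
    _ = (r * ‖θ‖ ^ 2) ^ 2 := by ring

end Covariance

section Cross

variable {p K L N : ℕ} {O : Fin K → Finset (Fin p)} {n : Fin K → ℕ} {ξ : Fin p → Fin L}
  {χ C CX lm lp R B κ : ℝ}

lemma crossSize_eq (hO : IsBlockPartition O ξ) (i j : Fin p) :
    (crossSize O n ξ (ξ j) (ξ i) : ℝ) = ∑ k, (n k : ℝ) * if i ∈ O k ∧ j ∈ O k then 1 else 0 := by
  have h : ∀ k, modality ξ (ξ j) ∪ modality ξ (ξ i) ⊆ O k ↔ i ∈ O k ∧ j ∈ O k := by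
    intro k
    obtain ⟨T, hT⟩ := hO.union k
    constructor
    · intro h
      exact ⟨h (by simp [modality]), h (by simp [modality])⟩
    · rintro ⟨hi, hj⟩ a ha
      rw [hT] at hi hj ⊢
      rcases Finset.mem_union.1 ha with h | h
      · rwa [(Finset.mem_filter.1 h).2]
      · rwa [(Finset.mem_filter.1 h).2]
  rw [crossSize, Fintype.sum_sigma]
  push_cast
  refine Finset.sum_congr rfl fun k _ => ?_
  simp [h]

/-- The total affinity defect of the data when a sign is flipped, for `ν` joint observations and
`N` unlabelled ones. -/
lemma shear_cost_le {m w g μ ν N ρ : ℝ} (hm : 0 < m) (hR : 0 < R) (hB : 0 < B) (hw : m / w ≤ 2)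
    (hw0 : 0 < w) (hμ : 0 ≤ μ) (hν : 0 ≤ ν) (hN : 0 ≤ N) (hρ0 : 0 < ρ) (hρ1 : ρ ≤ (2 * m) ^ 2)
    (hρ2 : ρ ≤ 2 * m) (hg : g = ρ * μ / (32 * B ^ 2 * m ^ 2)) (hμB : μ * (N + ν) ≤ B ^ 2)
    (hμR : μ * ν ≤ R ^ 2) :
    ν * (m * g * (1 / w + (B / 2) ^ 2 / R ^ 2) / 2) + N * (m * g / (2 * w)) ≤ 1 / 2 := by
  have hg0 : 0 ≤ g := by rw [hg]; positivity
  have hA : g * (N + ν) ≤ 1 / 8 := by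
    rw [hg, div_mul_eq_mul_div, div_le_iff₀ (by positivity)]
    calc ρ * μ * (N + ν) = ρ * (μ * (N + ν)) := by ring
      _ ≤ (2 * m) ^ 2 * B ^ 2 := mul_le_mul hρ1 hμB (by positivity) (by positivity)
      _ = _ := by ring
  have hA2 : g * ν * (m * B ^ 2 / (8 * R ^ 2)) ≤ 1 / 8 := by
    calc g * ν * (m * B ^ 2 / (8 * R ^ 2)) = ρ * (μ * ν) / (256 * m * R ^ 2) := by
          rw [hg]; field_simp; ring
      _ ≤ (2 * m) * R ^ 2 / (256 * m * R ^ 2) := by gcongr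
      _ ≤ 1 / 8 := by
          rw [div_le_div_iff₀ (by positivity) (by norm_num)]
          nlinarith [mul_pos hm (pow_pos hR 2)]
  calc ν * (m * g * (1 / w + (B / 2) ^ 2 / R ^ 2) / 2) + N * (m * g / (2 * w))
      = g * (N + ν) * (m / w / 2) + g * ν * (m * B ^ 2 / (8 * R ^ 2)) := by
        field_simp; ring
    _ ≤ g * (N + ν) * 1 + g * ν * (m * B ^ 2 / (8 * R ^ 2)) := by gcongr; linarith
    _ ≤ 1 / 2 := by linarith

/-- The contribution of the cross-covariances with the covariate `i`. The coefficient of `i` is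
`B / 2`, and the correlations `± c j` of the `i`-th with the other covariates have
random signs. The coefficients `∓ c j * B / 2` are chosen such that the `j`-th covariate is
uncorrelated with the response: these signs can only be inferred from joint observations of the
covariates `i` and `j`. -/
theorem cross_bound (hO : IsBlockPartition O ξ) (hR : 0 < R) (hB : 0 < B) (hlm : 0 < lm)
    (hlmp : lm < lp) (hχ : 0 < χ) (hχ1 : χ ≤ 1) (hC : 1 ≤ C) (hCX : √(8 * lp / 3) ≤ CX)
    (hκ : (105 : ℝ) ^ (1 / 4 : ℝ) ≤ κ) (i : Fin p) {μ : Fin p → ℝ} (hμ0 : ∀ j, 0 ≤ μ j)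
    (hμB : ∀ j, μ j * (N + crossSize O n ξ (ξ j) (ξ i)) ≤ B ^ 2)
    (hμR : ∀ j, μ j * crossSize O n ξ (ξ j) (ξ i) ≤ R ^ 2)
    (hμ : min 1 (lp ^ 2) * ∑ j ∈ Finset.univ.erase i, μ j ≤ 2 * B ^ 2 * (lp - lm) ^ 2) :
    ENNReal.ofReal (1 / 4096 * (min (lp ^ 2)⁻¹ 1 * ∑ j ∈ Finset.univ.erase i, μ j))
      ≤ minimaxRiskGauss O n N χ C CX lm lp R B κ := by
  classical
  have hlp : 0 < lp := hlm.trans hlmp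
  set m : ℝ := (lm + lp) / 2 with hm
  have hm0 : 0 < m := by positivity
  have hmlp : lp ≤ 2 * m := by rw [hm]; linarith
  have hmlp' : m ≤ lp := by rw [hm]; linarith
  set ρ : ℝ := min 1 (lp ^ 2) with hρ
  have hρ0 : 0 < ρ := lt_min one_pos (by positivity)
  have hρ1 : ρ ≤ 1 := min_le_left _ _
  have hρlp : ρ ≤ lp ^ 2 := min_le_right _ _
  have hρlp' : ρ ≤ lp := by
    rcases le_total 1 lp with h | h
    · exact hρ1.trans h
    · nlinarith
  -- The constant `32` keeps the eigenvalues in range and each flip undetectable.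
  set γ : Fin p → ℝ := fun j => √(ρ * μ j / (32 * B ^ 2 * m ^ 2)) with hγ
  have hγ2 : ∀ j, γ j ^ 2 = ρ * μ j / (32 * B ^ 2 * m ^ 2) := fun j =>
    Real.sq_sqrt (by have := hμ0 j; positivity)
  set c : (Fin p → Bool) → Fin p → ℝ := fun τ a =>
    if a = i then 0 else boolSign (τ a) * γ a with hc
  have hci : ∀ τ, c τ i = 0 := fun τ => by simp [hc]
  have hca : ∀ τ a, a ≠ i → c τ a = boolSign (τ a) * γ a := fun τ a h => by simp [hc, h]
  have hca2 : ∀ τ a, a ≠ i → c τ a ^ 2 = γ a ^ 2 := fun τ a h => by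
    rw [hca τ a h, mul_pow, boolSign_sq, one_mul]
  have hsum : ∀ τ, ∑ b, c τ b ^ 2 = ∑ b ∈ Finset.univ.erase i, γ b ^ 2 := by
    intro τ
    rw [← Finset.add_sum_erase _ _ (Finset.mem_univ i), hci]
    rw [Finset.sum_congr rfl fun b hb => hca2 τ b (Finset.ne_of_mem_erase hb)]
    simp
  set s : ℝ := ∑ b ∈ Finset.univ.erase i, γ b ^ 2 with hs
  have hsm : 4 * m ^ 2 * s ≤ ((lp - lm) / 2) ^ 2 := by
    have : s = ρ * (∑ j ∈ Finset.univ.erase i, μ j) / (32 * B ^ 2 * m ^ 2) := by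
      rw [hs, Finset.mul_sum, Finset.sum_div]
      exact Finset.sum_congr rfl fun b _ => hγ2 b
    rw [this]
    have h2 : 4 * m ^ 2 * (ρ * (∑ j ∈ Finset.univ.erase i, μ j) / (32 * B ^ 2 * m ^ 2))
        = ρ * (∑ j ∈ Finset.univ.erase i, μ j) / (8 * B ^ 2) := by field_simp; ring
    rw [h2, div_le_iff₀ (by positivity)]
    nlinarith
  have hs4 : s ≤ 1 / 4 := by
    have h1 : (lp - lm) / 2 ≤ m := by rw [hm]; linarith
    have h2 : ((lp - lm) / 2) ^ 2 ≤ m ^ 2 := pow_le_pow_left₀ (by linarith) h1 2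
    have h3 : 0 < m ^ 2 := by positivity
    nlinarith
  -- The innovation variance is lowered so that all covariates have the variance `m`.
  set v : Fin p → ℝ≥0 := fun a => (if a = i then m * (1 - s) else m).toNNReal with hv
  have hvc : ∀ τ, innovationVar m i (c τ) = v := fun τ => by
    funext a; rw [innovationVar, hsum]
  have hvi : (v i : ℝ) = m * (1 - s) := by
    rw [hv]; simp only [if_true]; exact Real.coe_toNNReal _ (mul_nonneg hm0.le (by linarith))
  have hvj : ∀ j, j ≠ i → (v j : ℝ) = m := fun j hj => by
    rw [hv]; simp only [if_neg hj]; exact Real.coe_toNNReal _ hm0.le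
  have hv0 : ∀ a, v a ≠ 0 := by
    intro a h
    have h' : (v a : ℝ) = 0 := by rw [h]; rfl
    by_cases ha : a = i
    · rw [ha, hvi] at h'; nlinarith
    · rw [hvj a ha] at h'; linarith
  set β : (Fin p → Bool) → EuclideanSpace ℝ (Fin p) := fun τ =>
    WithLp.toLp 2 fun a => if a = i then B / 2 else -c τ a * (B / 2) with hβ
  have hβi : ∀ τ, β τ i = B / 2 := fun τ => by simp [hβ]
  have hβa : ∀ τ a, a ≠ i → β τ a = -c τ a * β τ i := fun τ a h => by
    rw [hβi]; simp [hβ, h]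
  have hnorm : ∀ τ, ‖β τ‖ ≤ B := by
    intro τ
    refine abs_le_of_sq_le_sq' ?_ hB.le |>.2
    rw [EuclideanSpace.real_norm_sq_eq, ← Finset.add_sum_erase _ _ (Finset.mem_univ i), hβi]
    have : ∑ a ∈ Finset.univ.erase i, β τ a ^ 2 = s * (B / 2) ^ 2 := by
      rw [hs, Finset.sum_mul]
      refine Finset.sum_congr rfl fun a ha => ?_
      have ha' := Finset.ne_of_mem_erase ha
      rw [hβa τ a ha', mul_pow, neg_sq, hca2 τ a ha', hβi]
    rw [this]
    nlinarith [sq_nonneg B]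
  have hquad : ∀ τ θ, |quadForm v (shearMap i (c τ)) θ - m * ‖θ‖ ^ 2|
      ≤ (lp - lm) / 2 * ‖θ‖ ^ 2 := by
    intro τ θ
    rw [← hvc τ]
    exact abs_quadForm_innovationVar_sub_le hm0.le (by linarith) (hci τ)
      (by rw [hsum]; linarith) (by rw [hsum]; exact hsm) θ
  have hclass : ∀ τ, gaussianMechanism v (shearMap i (c τ)) (β τ) R hR.le
      ∈ classOSSGauss p χ C CX lm lp R B κ := by
    intro τ
    refine gaussianMechanism_mem_classOSSGauss _ _ _ _ hχ hχ1 hC hlm hlp hCX hκ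
      (fun θ => ?_) (fun θ => ?_) (hnorm τ) le_rfl
    · have := (abs_le.1 (hquad τ θ)).1
      rw [hm] at this
      linarith
    · have := (abs_le.1 (hquad τ θ)).2
      rw [hm] at this
      linarith
  have main := assouad_minimaxRiskGauss (O := O) (n := n) (N := N) hR hB hlm hlmp hχ hχ1 hC hCX hκ
    (fun τ => gaussianMechanism v (shearMap i (c τ)) (β τ) R hR.le) hclass (Finset.univ.erase i)
    (fun j => -γ j * (B / 2))
    (fun τ a ha => by
      have ha' := Finset.ne_of_mem_erase ha
      rw [gaussianMechanism_beta, hβa τ a ha', hca τ a ha', hβi]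
      ring)
    (fun τ j hj => by
      have hji := Finset.ne_of_mem_erase hj
      have hcj : c (flipAt j τ) j = -c τ j := by
        rw [hca _ j hji, hca _ j hji, flipAt_self, boolSign_not, neg_mul]
      have hcc : ∀ a, a ≠ j → c (flipAt j τ) a = c τ a := by
        intro a ha
        by_cases hai : a = i
        · rw [hai, hci, hci]
        · rw [hca _ a hai, hca _ a hai, flipAt_of_ne ha]
      have hββ : β (flipAt j τ) i = β τ i := by rw [hβi, hβi]
      have hvi0 : (0 : ℝ) < v i := by exact_mod_cast pos_iff_ne_zero.2 (hv0 i)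
      set E : ℝ := v j * c τ j ^ 2 * (1 / v i + β τ i ^ 2 / R ^ 2) / 2 with hE
      have hE0 : 0 ≤ E := by positivity
      refine (affinityDefectLE_dataLaw (e := fun k => if i ∈ O k ∧ j ∈ O k then E else 0)
        (e₀ := v j * c τ j ^ 2 / (2 * v i)) (fun k => ?_)
        (affinityDefectLE_covariateLaw_shear hv0 hR hji (hci τ) hcj hcc) (fun k => ?_)
        (by positivity)).mono ?_
      · split_ifs with hk
        · exact affinityDefectLE_observedLaw_shear hv0 hR hji (hci τ) hcj hcc (hβa τ)
            (hβa (flipAt j τ)) hββ (O k)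
        · rw [observedLaw_shear_eq hR hji (hci τ) hcj hcc (hβa τ) (hβa (flipAt j τ)) hββ hk]
          exact AffinityDefectLE.refl _
      · split_ifs
        · exact hE0
        · exact le_rfl
      · have h1 : ∑ k, (n k : ℝ) * (if i ∈ O k ∧ j ∈ O k then E else 0)
            = (crossSize O n ξ (ξ j) (ξ i) : ℝ) * E := by
          rw [crossSize_eq hO, Finset.sum_mul]
          refine Finset.sum_congr rfl fun k _ => ?_
          split_ifs <;> simp
        have hvv : m / v i ≤ 2 := by
          rw [div_le_iff₀ hvi0, hvi]; nlinarith
        rw [h1, hE, hvj j hji, hca2 τ j hji, hβi]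
        exact shear_cost_le hm0 hR hB hvv hvi0 (hμ0 j) (Nat.cast_nonneg _) (Nat.cast_nonneg _) hρ0
          (hρlp.trans (by gcongr)) (hρlp'.trans hmlp) (hγ2 j) (hμB j) (hμR j))
  refine le_trans (ENNReal.ofReal_le_ofReal ?_) main
  rw [Finset.mul_sum, Finset.mul_sum, Finset.mul_sum]
  refine Finset.sum_le_sum fun j _ => ?_
  rw [mul_pow, neg_sq, hγ2]
  -- `ρ / lp ^ 2` is exactly the minimum on the left.
  have h1 : min (lp ^ 2)⁻¹ 1 ≤ ρ / m ^ 2 := by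
    rw [le_div_iff₀ (by positivity)]
    have hmm : m ^ 2 ≤ lp ^ 2 := by gcongr
    have hm2 : 0 < m ^ 2 := by positivity
    refine le_min ?_ ?_
    · calc min (lp ^ 2)⁻¹ 1 * m ^ 2 ≤ (lp ^ 2)⁻¹ * lp ^ 2 := by
            gcongr; exact min_le_left _ _
        _ = 1 := inv_mul_cancel₀ (by positivity)
    · calc min (lp ^ 2)⁻¹ 1 * m ^ 2 ≤ 1 * lp ^ 2 := by
            gcongr; exact min_le_right _ _
        _ = _ := one_mul _
  calc 1 / 4096 * (min (lp ^ 2)⁻¹ 1 * μ j) ≤ 1 / 4096 * (ρ / m ^ 2 * μ j) := by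
        have := hμ0 j; gcongr
    _ = _ := by field_simp; ring

end Cross

/-! ### The minimax lower bound -/

section Terms

variable {k l : ℕ}

lemma toReal_min_div_mul_le_left {x y : ℝ} (hx : 0 ≤ x) :
    (min (ENNReal.ofReal x / (k : ℝ≥0∞)) (ENNReal.ofReal y / (l : ℝ≥0∞))).toReal * k ≤ x := by
  rw [← ENNReal.toReal_natCast, ← ENNReal.toReal_mul]
  refine ENNReal.toReal_le_of_le_ofReal hx ?_
  exact ENNReal.mul_le_of_le_div (min_le_left _ _)

lemma toReal_min_div_mul_le_right {x y : ℝ} (hy : 0 ≤ y) :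
    (min (ENNReal.ofReal x / (k : ℝ≥0∞)) (ENNReal.ofReal y / (l : ℝ≥0∞))).toReal * l ≤ y := by
  rw [min_comm]
  exact toReal_min_div_mul_le_left hy

end Terms

end OSS

theorem mainTheorem3 :
    ∃ c : ℝ, 0 < c ∧
      ∀ (p K L N : ℕ) (O : Fin K → Finset (Fin p)) (n : Fin K → ℕ) (ξ : Fin p → Fin L)
        (χ C CX lm lp R B κ : ℝ),
        (∀ a : Fin p, ∃ k, a ∈ O k) →
        OSS.IsModalityMap O ξ →
        0 < R → 0 < B → 0 < lm → lm < lp →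
        0 < χ → χ ≤ 1 → 1 ≤ C →
        Real.sqrt (8 * lp / 3) ≤ CX →
        (105 : ℝ) ^ (1 / 4 : ℝ) ≤ κ →
        (∀ i : Fin p, ∀ z : EuclideanSpace ℝ (Fin p), ‖z‖ ≤ B →
          1 / 2 * max (1 / lm) lm * max (R ^ 2 / B ^ 2) (B ^ 2 / R ^ 2) * p
            ≤ OSS.effSize O n R z i) →
        (∀ i : Fin p,
          ENNReal.ofReal (min 1 (lp ^ 2)) * OSS.crossSum O n N ξ R B i
            ≤ ENNReal.ofReal (2 * B ^ 2 * (lp - lm) ^ 2)) →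
        (∀ i : Fin L, 2 ≤ (OSS.modality ξ i).card) →
        ENNReal.ofReal c *
            ((⨆ (z : EuclideanSpace ℝ (Fin p)) (_ : ‖z‖ ≤ B),
                ENNReal.ofReal (R ^ 2 / max 1 lm * ∑ i : Fin p, 1 / OSS.effSize O n R z i)) +
              ENNReal.ofReal (min ((lp ^ 2)⁻¹) 1) *
                ⨆ i : Fin p, OSS.crossSum O n N ξ R B i)
          ≤ OSS.minimaxRiskGauss O n N χ C CX lm lp R B κ := by
  -- Each of the two terms is bounded separately, with constant `1 / 4096` or better.
  refine ⟨1 / 8192, by norm_num, ?_⟩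
  intro p K L N O n ξ χ C CX lm lp R B κ _ hξ hR hB hlm hlmp hχ hχ1 hC hCX hκ hα hcross hcard
  set M := OSS.minimaxRiskGauss O n N χ C CX lm lp R B κ with hM
  have hlp : 0 < lp := hlm.trans hlmp
  have hρ0 : 0 < min 1 (lp ^ 2) := lt_min one_pos (by positivity)
  have hmin0 : 0 ≤ min (lp ^ 2)⁻¹ 1 := le_min (by positivity) zero_le_one
  have h1 : ENNReal.ofReal (1 / 4096) * (⨆ (z : EuclideanSpace ℝ (Fin p)) (_ : ‖z‖ ≤ B),
      ENNReal.ofReal (R ^ 2 / max 1 lm * ∑ i : Fin p, 1 / OSS.effSize O n R z i)) ≤ M := by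
    simp_rw [ENNReal.mul_iSup]
    refine iSup₂_le fun z hz => ?_
    refine le_trans ?_ (OSS.effSize_bound hξ.toIsBlockPartition hR hB hlm hlmp hχ hχ1 hC hCX hκ hz
      (fun i => hα i z hz) hcard)
    rw [ENNReal.ofReal_mul (by norm_num : (0 : ℝ) ≤ 1 / 256)]
    gcongr
    norm_num
  have h2 : ENNReal.ofReal (1 / 4096) * (ENNReal.ofReal (min ((lp ^ 2)⁻¹) 1) *
      ⨆ i : Fin p, OSS.crossSum O n N ξ R B i) ≤ M := by
    simp_rw [ENNReal.mul_iSup]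
    refine iSup_le fun i => ?_
    set t : Fin p → ℝ≥0∞ := fun j =>
      min (ENNReal.ofReal (B ^ 2) / ((N + OSS.crossSize O n ξ (ξ j) (ξ i) : ℕ) : ℝ≥0∞))
        (ENNReal.ofReal (R ^ 2) / (OSS.crossSize O n ξ (ξ j) (ξ i) : ℝ≥0∞)) with ht
    have hsum : OSS.crossSum O n N ξ R B i = ∑ j ∈ Finset.univ.erase i, t j := rfl
    -- `N + n_{ξ(j),ξ(i)} = 0` is excluded: the hypothesis on the cross sums would fail.
    have htop : OSS.crossSum O n N ξ R B i ≠ ∞ := by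
      intro h
      have := hcross i
      rw [h, ENNReal.mul_top (ENNReal.ofReal_pos.2 hρ0).ne'] at this
      exact absurd this (not_le.2 ENNReal.ofReal_lt_top)
    have hreal : OSS.crossSum O n N ξ R B i
        = ENNReal.ofReal (∑ j ∈ Finset.univ.erase i, (t j).toReal) := by
      rw [hsum, ← ENNReal.toReal_sum fun j hj => ?_, ENNReal.ofReal_toReal (hsum ▸ htop)]
      exact ne_top_of_le_ne_top (hsum ▸ htop)
        (Finset.single_le_sum (f := t) (fun _ _ => zero_le) hj)
    have key := OSS.cross_bound (N := N) (n := n) (μ := fun j => (t j).toReal)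
      hξ.toIsBlockPartition hR hB hlm hlmp hχ hχ1 hC hCX hκ i
      (fun j => ENNReal.toReal_nonneg)
      (fun j => by
        have := OSS.toReal_min_div_mul_le_left (k := N + OSS.crossSize O n ξ (ξ j) (ξ i))
          (l := OSS.crossSize O n ξ (ξ j) (ξ i)) (x := B ^ 2) (y := R ^ 2) (sq_nonneg B)
        push_cast at this ⊢
        simpa [ht] using this)
      (fun j => OSS.toReal_min_div_mul_le_right (sq_nonneg R))
      (by
        have := hcross i
        rw [hreal, ← ENNReal.ofReal_mul hρ0.le,
          ENNReal.ofReal_le_ofReal_iff (by positivity)] at this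
        exact this)
    rwa [ENNReal.ofReal_mul (by norm_num), ENNReal.ofReal_mul hmin0, ← hreal] at key
  have h3 : ENNReal.ofReal (1 / 8192) = ENNReal.ofReal (1 / 2) * ENNReal.ofReal (1 / 4096) := by
    rw [← ENNReal.ofReal_mul (by norm_num)]; norm_num
  rw [h3, mul_assoc, mul_add]
  calc _ ≤ ENNReal.ofReal (1 / 2) * (M + M) := by gcongr
    _ = M := by
        rw [← two_mul, ← mul_assoc, show (2 : ℝ≥0∞) = ENNReal.ofReal 2 by simp,
          ← ENNReal.ofReal_mul (by norm_num)]
        norm_num
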